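/- Let $0<r_1<r_2<\infty$ and $A=\{\zeta\in\mathbb C : r_1\le|\zeta|\le r_2\}$. For $a\in\mathbb C$ and $\rho>0$ write $\Delta(a,\rho)=\{\zeta\in\mathbb C:|\zeta-a|<\rho\}$, $\overline\Delta(a,\rho)$ for its closure and $b\Delta(a,\rho)$ for its boundary circle; the circle $b\Delta(a,\rho)$ surrounds the origin if $0\in\Delta(a,\rho)$. A complex-valued function $f$ is Hölder continuous on $K\subset\mathbb C$ if there are constants $M<\infty$ and $0<\alpha<1$ such that $|f(z)-f(w)|\le M|z-w|^\alpha$ for all $z,w\in K$. **Theorem 1.1.** Let $f$ be a Hölder continuous function on $A$ such that $$\frac1{2\pi}\int_0^{2\pi} f(a+\rho e^{i\theta})\,d\theta=0$$ for every circle $b\Delta(a,\rho)\subset A$ which surrounds the origin. Then $f=f^++f^-$ on $A$, where $f^+$ and $f^-$ are Hölder continuous functions on $A$ such that for each circle $b\Delta(a,\rho)\subset A$ which surrounds the origin, 1. $f^+|_{b\Delta(a,\rho)}$ has a continuous extension to $\overline\Delta(a,\rho)$ which is holomorphic on $\Delta(a,\rho)$, and 2. $f^-|_{b\Delta(a,\rho)}$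 has a continuous extension to $(\mathbb C\cup\{\infty\})\setminus\Delta(a,\rho)$ which is holomorphic on $(\mathbb C\cup\{\infty\})\setminus\overline\Delta(a,\rho)$ and vanishes at $\infty$. -/

import Mathlib

open Set Metric
open scoped NNReal OnePoint

/-- The closed annulus with inner radius `r₁` and outer radius `r₂`, centred at the origin. -/
def closedAnnulus (r₁ r₂ : ℝ) : Set ℂ := {z | r₁ ≤ ‖z‖ ∧ ‖z‖ ≤ r₂}

/-- Hölder continuity on `K`, with some constant and some exponent strictly between `0` and `1`. -/
def IsHolderOn (f : ℂ → ℂ) (K : Set ℂ) : Prop :=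
  ∃ M α : ℝ≥0, 0 < α ∧ α < 1 ∧ HolderOnWith M α f K

/-- The circle with centre `a` and radius `ρ` is contained in `K` and surrounds the origin, that is,
the origin lies in the open disc that it bounds. -/
def IsSurroundingCircleIn (K : Set ℂ) (a : ℂ) (ρ : ℝ) : Prop :=
  0 < ρ ∧ sphere a ρ ⊆ K ∧ (0 : ℂ) ∈ ball a ρ

/-- The chart `w ↦ 1 / w` of the Riemann sphere `ℂ ∪ {∞}` around the point `∞`. -/
noncomputable def chartAtInfty (w : ℂ) : OnePoint ℂ :=
  open Classical in if w = 0 then ∞ else ((w⁻¹ : ℂ) : OnePoint ℂ)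

/-- Holomorphy of a function on an open subset `U` of the Riemann sphere, read in the two standard
charts `z ↦ z` and `w ↦ 1 / w`. -/
def IsHolomorphicOnSphere (g : OnePoint ℂ → ℂ) (U : Set (OnePoint ℂ)) : Prop :=
  DifferentiableOn ℂ (fun z : ℂ => g (z : OnePoint ℂ)) {z : ℂ | (z : OnePoint ℂ) ∈ U} ∧
  DifferentiableOn ℂ (fun w : ℂ => g (chartAtInfty w)) {w : ℂ | chartAtInfty w ∈ U}

/-- The restriction of `h` to the circle with centre `a` and radius `ρ` has a continuous extension
to the closed disc which is holomorphic on the open disc. -/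
def ExtendsHolomorphicallyInside (h : ℂ → ℂ) (a : ℂ) (ρ : ℝ) : Prop :=
  ∃ g : ℂ → ℂ, ContinuousOn g (closedBall a ρ) ∧ DifferentiableOn ℂ g (ball a ρ) ∧
    ∀ z ∈ sphere a ρ, g z = h z

/-- The restriction of `h` to the circle with centre `a` and radius `ρ` has a continuous extension
to the Riemann sphere minus the open disc, which is holomorphic on the Riemann sphere minus the
closed disc and vanishes at `∞`. -/
def ExtendsHolomorphicallyOutside (h : ℂ → ℂ) (a : ℂ) (ρ : ℝ) : Prop :=
  ∃ g : OnePoint ℂ → ℂ,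
    ContinuousOn g ((fun z : ℂ => (z : OnePoint ℂ)) '' ball a ρ)ᶜ ∧
    IsHolomorphicOnSphere g ((fun z : ℂ => (z : OnePoint ℂ)) '' closedBall a ρ)ᶜ ∧
    g ∞ = 0 ∧
    ∀ z ∈ sphere a ρ, g (z : OnePoint ℂ) = h z

/-!
The splitting is the one given, on each circle `|z| = r`, by the nonnegative and the nonpositive
frequencies of the Fourier series of `f`. Expand `f = ∑ f_n`, where `f_n (r e^{iφ})` is `e^{inφ}`
times a function of `r` (`angularPart`). The hypothesis is invariant under rotations, so every `f_n`
has vanishing averages over the surrounding circles as well (`circleAverage_angularPart`).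

For `n ≥ 0` this determines `f_n` up to finitely many constants. Write `f_n = K(|z|²) / z̄ ^ n`. If
`K` is smooth, then `∂ / ∂z` preserves the vanishing of the averages and turns `K(|z|²) / z̄ ^ n` into
`K'(|z|²) / z̄ ^ (n - 1)`; after `n` steps the averages over circles centred at the origin give
`K^(n) = 0` (`exists_polynomial_of_contDiffOn`). A continuous `K` is smoothed in the variable
`log |z|`, which respects the hypothesis because dilations do (`exists_polynomial_of_continuous`).
So `f_n` is a combination of the functions `z ^ i / z̄ ^ (n - i)` with `i < n`; in particular
`f_0 = 0`. On a circle `|z - a| = ρ` around the origin, `1 / z̄ = (z - a) / (ā (z - a) + ρ²)`, which is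
holomorphic on the disc and vanishes at `a`; so `f_n` extends to the disc, with value `0` at `a`
(`extendsInsideVanishing_conjPowMul`).

The sum `f⁺` of the `f_n` with `n ≥ 0` is a singular Cauchy integral (`cauchyProjection`). It is
the uniform limit of the Abel means `∑ t ^ n f_n` as `t → 1`, at the rate `(1 - t) ^ (α / 2)`
(`exists_norm_abelMean_sub_le`). The rate, together with the crude Hölder constant `M / (1 - t)` of
the Abel mean, makes `f⁺` Hölder continuous (`exists_norm_cauchyProjection_sub_le`). Uniform
convergence and the maximum principle extend `f⁺` to every disc in question
(`extendsInsideVanishing_cauchyProjection`). Finally `f⁻` is the conjugate of the projection of `f̄`,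
and `f⁺ + f⁻ = f + f_0 = f` (`cauchyProjection_add_conj`). The extension of `f⁻` to the
exterior is obtained by reflection in the circle, and its value at `∞` is the value `0` at the centre
(`ExtendsInsideVanishing.conj_outside`).
-/

/-! ### Differentiating circle averages in the centre -/

/-- Differentiation under the integral sign: moving the centre of a circle in the direction `v`
differentiates the circle average by averaging the directional derivative. -/
theorem hasDerivAt_circleAverage_center {F D : ℂ → ℂ} {U : Set ℂ} (hU : IsOpen U)
    (hF : ContinuousOn F U) (hD : ContinuousOn D U) (v : ℂ)
    (hFD : ∀ z ∈ U, HasDerivAt (fun t : ℝ => F (z + t * v)) (D z) 0) {a : ℂ} {ρ : ℝ}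
    (hρ : 0 ≤ ρ) (hs : sphere a ρ ⊆ U) :
    HasDerivAt (fun t : ℝ => Real.circleAverage F (a + t * v) ρ)
      (Real.circleAverage D a ρ) 0 := by
  obtain ⟨δ, hδ, hδU⟩ := (isCompact_sphere a ρ).exists_cthickening_subset_open hU hs
  obtain ⟨C, hC⟩ := ((isCompact_sphere a ρ).cthickening (r := δ)).exists_bound_of_continuousOn
    (hD.mono hδU)
  have hmem : ∀ t ∈ ball (0 : ℝ) (δ / (‖v‖ + 1)), ∀ θ : ℝ,
      circleMap a ρ θ + t * v ∈ cthickening δ (sphere a ρ) := by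
    intro t ht θ
    refine mem_cthickening_of_dist_le _ (circleMap a ρ θ) _ _ (circleMap_mem_sphere a hρ θ) ?_
    rw [mem_ball_zero_iff, lt_div_iff₀ (by positivity)] at ht
    simp only [dist_self_add_left, norm_mul, Complex.norm_real]
    nlinarith [norm_nonneg t]
  have hcont : ∀ {G : ℂ → ℂ}, ContinuousOn G U → ∀ t ∈ ball (0 : ℝ) (δ / (‖v‖ + 1)),
      Continuous (fun θ : ℝ => G (circleMap a ρ θ + t * v)) := by
    intro G hG t ht
    exact hG.comp_continuous (by fun_prop) fun θ => hδU (hmem t ht θ)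
  have h0 : (0 : ℝ) ∈ ball (0 : ℝ) (δ / (‖v‖ + 1)) := mem_ball_self (by positivity)
  have key := (intervalIntegral.hasDerivAt_integral_of_dominated_loc_of_deriv_le
    (μ := MeasureTheory.volume) (a := 0) (b := 2 * Real.pi)
    (F := fun (t : ℝ) (θ : ℝ) => F (circleMap a ρ θ + t * v))
    (F' := fun (t : ℝ) (θ : ℝ) => D (circleMap a ρ θ + t * v)) (bound := fun _ => C)
    (isOpen_ball.mem_nhds h0) ?_ ?_ ?_ ?_ ?_ ?_).2
  · have := key.const_smul (2 * Real.pi)⁻¹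
    convert! this using 2 with t
    · rw [Real.circleAverage_def]
      congr 2
      ext θ
      simp only [circleMap]
      ring_nf
    · simp [Real.circleAverage_def]
  · filter_upwards [isOpen_ball.mem_nhds h0] with t ht
    exact (hcont hF t ht).aestronglyMeasurable
  · exact (hcont hF 0 h0).intervalIntegrable _ _
  · exact (hcont hD 0 h0).aestronglyMeasurable
  · exact Filter.Eventually.of_forall fun θ _ t ht => hC _ (hmem t ht θ)
  · exact intervalIntegrable_const
  · refine Filter.Eventually.of_forall fun θ _ t ht => ?_
    have := hFD _ (hδU (hmem t ht θ))
    rw [← sub_self t] at this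
    have h2 := HasDerivAt.comp_sub_const (𝕜 := ℝ) t t this
    convert! h2 using 2 with s
    push_cast
    ring_nf

/-! ### The angular components with smooth radial part -/

/-- The function `K (|z|²) / z̄ ^ n`. Every function `F` on `ℂ \ {0}` with
`F (u z) = u ^ n F z` for all unimodular `u` has this form. -/
noncomputable def conjPowMul (n : ℕ) (K : ℝ → ℂ) (z : ℂ) : ℂ :=
  ((starRingEnd ℂ) z)⁻¹ ^ n * K (Complex.normSq z)

theorem continuousOn_conjPowMul (n : ℕ) {K : ℝ → ℂ} (hK : ContinuousOn K (Ioi 0)) :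
    ContinuousOn (conjPowMul n K) {0}ᶜ := by
  refine ContinuousOn.mul ((ContinuousOn.inv₀ (by fun_prop) ?_).pow n) ?_
  · intro z hz; simpa using hz
  · exact hK.comp Complex.continuous_normSq.continuousOn fun z hz => Complex.normSq_pos.2 hz

theorem hasDerivAt_conjPowMul (n : ℕ) {K : ℝ → ℂ} {K' z v : ℂ} (hz : z ≠ 0)
    (hK : HasDerivAt K K' (Complex.normSq z)) :
    HasDerivAt (fun t : ℝ => conjPowMul (n + 1) K (z + t * v))
      (-(n + 1) * (starRingEnd ℂ) v * ((starRingEnd ℂ) z)⁻¹ ^ (n + 2) * K (Complex.normSq z)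
        + ((starRingEnd ℂ) z)⁻¹ ^ (n + 1) *
          (((2 * (v * (starRingEnd ℂ) z).re : ℝ) : ℂ) * K')) 0 := by
  have h0 : (starRingEnd ℂ) z ≠ 0 := by simpa using hz
  have h1 : HasDerivAt (fun t : ℝ => (starRingEnd ℂ) (z + t * v)) ((starRingEnd ℂ) v) 0 := by
    have := ((Complex.ofRealCLM.hasDerivAt (x := 0)).mul_const ((starRingEnd ℂ) v)).const_add
      ((starRingEnd ℂ) z)
    simpa using this
  have h2 : HasDerivAt (fun t : ℝ => Complex.normSq (z + t * v))
      (2 * (v * (starRingEnd ℂ) z).re) 0 := by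
    have e : (fun t : ℝ => Complex.normSq (z + t * v)) = fun t : ℝ =>
        Complex.normSq z + t ^ 2 * Complex.normSq v + t * (2 * (v * (starRingEnd ℂ) z).re) := by
      ext t
      simp only [Complex.normSq_apply, Complex.add_re, Complex.mul_re, Complex.ofReal_re,
        Complex.ofReal_im, Complex.add_im, Complex.mul_im, Complex.conj_re, Complex.conj_im]
      ring
    rw [e]
    have := ((((hasDerivAt_id (0 : ℝ)).pow 2).mul_const (Complex.normSq v)).const_add
      (Complex.normSq z)).add ((hasDerivAt_id (0 : ℝ)).mul_const (2 * (v * (starRingEnd ℂ) z).re))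
    convert! this using 1
    simp
  have h3 : HasDerivAt (fun t : ℝ => K (Complex.normSq (z + t * v)))
      (((2 * (v * (starRingEnd ℂ) z).re : ℝ) : ℂ) * K') 0 := by
    have hK0 : HasDerivAt K K' (Complex.normSq (z + ((0 : ℝ) : ℂ) * v)) := by simpa using hK
    simpa [Function.comp_def] using! hK0.scomp (0 : ℝ) h2
  have h4 := ((h1.inv (by simpa using h0)).pow (n + 1)).mul h3
  convert! h4 using 1
  simp only [Pi.inv_apply, Pi.pow_apply, Complex.ofReal_zero, zero_mul, add_zero,
    Nat.add_sub_cancel, Nat.cast_add, Nat.cast_one]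
  rw [div_eq_mul_inv, ← inv_pow]
  ring

/-- If the circle averages of `K (|z|²) / z̄ ^ (n + 1)` vanish, then so do those of
`K' (|z|²) / z̄ ^ n`, which is the Wirtinger derivative `∂ / ∂z` of that function. -/
theorem circleAverage_conjPowMul_deriv (n : ℕ) {K K' : ℝ → ℂ} {r₁ r₂ : ℝ} (hr₁ : 0 ≤ r₁)
    (hK : ∀ s > 0, HasDerivAt K (K' s) s) (hK' : ContinuousOn K' (Ioi 0))
    (h : ∀ (a : ℂ) (ρ : ℝ), r₁ < ρ - ‖a‖ → ρ + ‖a‖ < r₂ →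
      Real.circleAverage (conjPowMul (n + 1) K) a ρ = 0)
    (a : ℂ) (ρ : ℝ) (h₁ : r₁ < ρ - ‖a‖) (h₂ : ρ + ‖a‖ < r₂) :
    Real.circleAverage (conjPowMul n K') a ρ = 0 := by
  have hKc : ContinuousOn K (Ioi 0) := fun s hs => (hK s hs).continuousAt.continuousWithinAt
  have hρ : 0 ≤ ρ := by linarith [norm_nonneg a]
  have hsph : sphere a ρ ⊆ ({0}ᶜ : Set ℂ) := by
    rintro z hz rfl
    simp only [mem_sphere, dist_zero_left] at hz
    linarith
  let D : ℂ → ℂ → ℂ := fun v z =>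
    -(n + 1) * (starRingEnd ℂ) v * ((starRingEnd ℂ) z)⁻¹ ^ (n + 2) * K (Complex.normSq z)
        + ((starRingEnd ℂ) z)⁻¹ ^ (n + 1) *
          (((2 * (v * (starRingEnd ℂ) z).re : ℝ) : ℂ) * K' (Complex.normSq z))
  have hDc : ∀ v, ContinuousOn (D v) {0}ᶜ := by
    intro v
    have hi : ContinuousOn (fun z : ℂ => ((starRingEnd ℂ) z)⁻¹) {0}ᶜ :=
      ContinuousOn.inv₀ (by fun_prop) fun z hz => by simpa using hz
    have hm : MapsTo Complex.normSq {0}ᶜ (Ioi 0) := fun z hz => Complex.normSq_pos.2 hz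
    have c1 := hKc.comp Complex.continuous_normSq.continuousOn hm
    have c2 := hK'.comp Complex.continuous_normSq.continuousOn hm
    exact ((continuousOn_const.mul (hi.pow _)).mul c1).add
      ((hi.pow _).mul (ContinuousOn.mul (by fun_prop) c2))
  have hD0 : ∀ v, Real.circleAverage (D v) a ρ = 0 := by
    intro v
    have hd := hasDerivAt_circleAverage_center isOpen_compl_singleton
      (continuousOn_conjPowMul (n + 1) hKc) (hDc v) v
      (fun z hz => hasDerivAt_conjPowMul n hz (hK _ (Complex.normSq_pos.2 hz))) hρ hsph
    refine hd.unique ((hasDerivAt_const (0 : ℝ) (0 : ℂ)).congr_of_eventuallyEq ?_)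
    have hc : Continuous fun t : ℝ => ‖a + t * v‖ := by fun_prop
    have e1 : ∀ᶠ t : ℝ in nhds 0, ‖a + t * v‖ < ρ - r₁ :=
      hc.continuousAt.eventually_lt continuousAt_const (by simp; linarith)
    have e2 : ∀ᶠ t : ℝ in nhds 0, ‖a + t * v‖ < r₂ - ρ :=
      hc.continuousAt.eventually_lt continuousAt_const (by simp; linarith)
    filter_upwards [e1, e2] with t ht1 ht2
    exact h _ _ (by linarith) (by linarith)
  have hci : ∀ v, CircleIntegrable (D v) a ρ := fun v =>
    ((hDc v).mono hsph).circleIntegrable hρ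
  -- `∂ / ∂z = (∂ / ∂x - i ∂ / ∂y) / 2`
  have hcomb : EqOn (conjPowMul n K')
      (fun z => (1 / 2 : ℂ) • D 1 z - (Complex.I / 2) • D Complex.I z)
      (sphere a |ρ|) := by
    intro z hz
    rw [abs_of_nonneg hρ] at hz
    have hz0 : (starRingEnd ℂ) z ≠ 0 := by simpa using hsph hz
    have e : ((2 * (1 * (starRingEnd ℂ) z).re : ℝ) : ℂ) -
        Complex.I * ((2 * (Complex.I * (starRingEnd ℂ) z).re : ℝ) : ℂ) = 2 * (starRingEnd ℂ) z := by
      apply Complex.ext <;> simp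
    have e' : ((starRingEnd ℂ) z)⁻¹ ^ (n + 1) * (starRingEnd ℂ) z = ((starRingEnd ℂ) z)⁻¹ ^ n := by
      rw [pow_succ, mul_assoc, inv_mul_cancel₀ hz0, mul_one]
    simp only [conjPowMul, D, smul_eq_mul, Complex.conj_I, map_one]
    linear_combination (-1 / 2) * ((starRingEnd ℂ) z)⁻¹ ^ (n + 1) * K' (Complex.normSq z) * e
      - K' (Complex.normSq z) * e'
      + (1 / 2) * (n + 1) * ((starRingEnd ℂ) z)⁻¹ ^ (n + 2) * K (Complex.normSq z) * Complex.I_sq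
  rw [Real.circleAverage_congr_sphere hcomb, Real.circleAverage_fun_sub
    (f₁ := fun z => (1 / 2 : ℂ) • D 1 z) (f₂ := fun z => (Complex.I / 2) • D Complex.I z)
    (hci 1).const_smul (hci Complex.I).const_smul, Real.circleAverage_fun_smul,
    Real.circleAverage_fun_smul, hD0, hD0]
  simp

theorem Polynomial.exists_derivative_eq_degree_lt {n : ℕ} {q : Polynomial ℂ} (hq : q.degree < n) :
    ∃ p : Polynomial ℂ, p.derivative = q ∧ p.degree < (n + 1 : ℕ) := by
  refine ⟨∑ i ∈ Finset.range n, Polynomial.monomial (i + 1) (q.coeff i / (i + 1)), ?_, ?_⟩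
  · ext j
    rw [Polynomial.coeff_derivative, Polynomial.finsetSum_coeff]
    simp only [Polynomial.coeff_monomial, add_left_inj, Finset.sum_ite_eq', Finset.mem_range]
    have : (j : ℂ) + 1 ≠ 0 := by exact_mod_cast j.succ_ne_zero
    split_ifs with hj
    · field_simp
    · rw [zero_mul, Polynomial.coeff_eq_zero_of_degree_lt
        (hq.trans_le (by exact_mod_cast not_lt.1 hj))]
  · refine Polynomial.mem_degreeLT.1 (Submodule.sum_mem _ fun i hi => Polynomial.mem_degreeLT.2 ?_)
    refine (Polynomial.degree_monomial_le _ _).trans_lt ?_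
    exact_mod_cast Nat.succ_lt_succ (Finset.mem_range.1 hi)

/-- A smooth function `K` for which all circle averages of `K (|z|²) / z̄ ^ n` over circles in the
annulus `r₁ < |z| < r₂` that surround the origin vanish is a polynomial of degree less than `n`:
each `∂ / ∂z` lowers `n` by one and differentiates `K`, and for `n = 0` the circles centred at the
origin give `K = 0`. -/
theorem exists_polynomial_of_contDiffOn {r₁ r₂ : ℝ} (hr₁ : 0 ≤ r₁) (hr₂ : 0 ≤ r₂) (n : ℕ) :
    ∀ K : ℝ → ℂ, ContDiffOn ℝ n K (Ioi 0) →
      (∀ (a : ℂ) (ρ : ℝ), r₁ < ρ - ‖a‖ → ρ + ‖a‖ < r₂ →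
        Real.circleAverage (conjPowMul n K) a ρ = 0) →
      ∃ p : Polynomial ℂ, p.degree < n ∧ ∀ s ∈ Ioo (r₁ ^ 2) (r₂ ^ 2), K s = p.eval (s : ℂ) := by
  induction n with
  | zero =>
    intro K _ h
    refine ⟨0, by simp, fun s hs => ?_⟩
    have hs0 : 0 ≤ s := (sq_nonneg r₁).trans hs.1.le
    have h1 : r₁ < √s := Real.lt_sqrt_of_sq_lt hs.1
    have h2 : √s < r₂ := (Real.sqrt_lt' (hr₂.lt_of_ne fun e => ?_)).2 hs.2
    · have := h 0 √s (by simpa using h1) (by simpa using h2)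
      rw [Real.circleAverage_const_on_circle (a := K s)] at this
      · simpa using this
      · intro z hz
        rw [mem_sphere_zero_iff_norm, abs_of_nonneg (Real.sqrt_nonneg s)] at hz
        simp [conjPowMul, Complex.normSq_eq_norm_sq, hz, Real.sq_sqrt hs0]
    · have := hs.2
      rw [← e] at this
      linarith [sq_nonneg r₁, hs.1]
  | succ n ih =>
    intro K hK h
    have hK1 : ∀ s > 0, HasDerivAt K (deriv K s) s := fun s hs =>
      ((hK.differentiableOn (by simp)).differentiableAt (Ioi_mem_nhds hs)).hasDerivAt
    have hK2 : ContDiffOn ℝ n (deriv K) (Ioi 0) := by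
      refine ((contDiffOn_succ_iff_deriv_of_isOpen isOpen_Ioi).1 ?_).2.2
      exact_mod_cast hK
    obtain ⟨q, hq, hqK⟩ := ih (deriv K) hK2
      (circleAverage_conjPowMul_deriv n hr₁ hK1 hK2.continuousOn h)
    obtain ⟨p, hp, hpd⟩ := Polynomial.exists_derivative_eq_degree_lt hq
    have hsub : Ioo (r₁ ^ 2) (r₂ ^ 2) ⊆ Ioi 0 := fun s hs => (sq_nonneg r₁).trans_lt hs.1
    have hderiv : ∀ s ∈ Ioo (r₁ ^ 2) (r₂ ^ 2),
        HasDerivAt (fun s : ℝ => K s - p.eval (s : ℂ)) 0 s := by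
      intro s hs
      have := (hK1 s (hsub hs)).sub ((p.hasDerivAt (s : ℂ)).comp_ofReal)
      rwa [hp, hqK s hs, sub_self] at this
    rcases (Ioo (r₁ ^ 2) (r₂ ^ 2)).eq_empty_or_nonempty with he | ⟨s₀, hs₀⟩
    · exact ⟨0, by simp, by simp [he]⟩
    refine ⟨p + Polynomial.C (K s₀ - p.eval (s₀ : ℂ)), ?_, fun s hs => ?_⟩
    · refine (Polynomial.degree_add_le _ _).trans_lt (max_lt hpd ?_)
      exact Polynomial.degree_C_le.trans_lt (by exact_mod_cast n.succ_pos)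
    · have := isOpen_Ioo.is_const_of_deriv_eq_zero isPreconnected_Ioo
        (fun s hs => (hderiv s hs).differentiableAt.differentiableWithinAt)
        (fun s hs => (hderiv s hs).deriv) hs hs₀
      simp only [Polynomial.eval_add, Polynomial.eval_C]
      linear_combination this

/-! ### Circle averages: Fubini and rescaling -/

theorem circleAverage_intervalIntegral_swap (a : ℂ) (ρ : ℝ) {G : ℝ → ℂ → ℂ}
    (hG : Continuous fun p : ℝ × ℝ => G p.1 (circleMap a ρ p.2)) (x y : ℝ) :
    Real.circleAverage (fun z => ∫ t in x..y, G t z) a ρ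
      = ∫ t in x..y, Real.circleAverage (G t) a ρ := by
  have hint : MeasureTheory.Integrable (Function.uncurry fun t θ => G t (circleMap a ρ θ))
      ((MeasureTheory.volume.restrict (uIoc x y)).prod
        (MeasureTheory.volume.restrict (Ioc 0 (2 * Real.pi)))) := by
    rw [MeasureTheory.Measure.prod_restrict]
    exact (hG.continuousOn.integrableOn_compact (isCompact_uIcc.prod isCompact_Icc)).mono_set
      (prod_mono uIoc_subset_uIcc Ioc_subset_Icc_self)
  have := MeasureTheory.intervalIntegral_integral_swap hint
  simp only [Real.circleAverage_def]
  rw [intervalIntegral.integral_smul]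
  simp only [intervalIntegral.integral_of_le Real.two_pi_pos.le]
  rw [this]

/-- Fubini's theorem for two circle averages. -/
theorem circleAverage_swap (a b : ℂ) (ρ σ : ℝ) {G : ℂ → ℂ → ℂ}
    (hG : Continuous fun p : ℝ × ℝ => G (circleMap b σ p.1) (circleMap a ρ p.2)) :
    Real.circleAverage (fun z => Real.circleAverage (fun u => G u z) b σ) a ρ
      = Real.circleAverage (fun u => Real.circleAverage (fun z => G u z) a ρ) b σ := by
  have := circleAverage_intervalIntegral_swap a ρ (G := fun t z => G (circleMap b σ t) z) hG
    0 (2 * Real.pi)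
  simp only [Real.circleAverage_def (c := b)]
  rw [← this, ← Real.circleAverage_fun_smul]

theorem circleAverage_comp_ofReal_mul (f : ℂ → ℂ) (c : ℝ) (a : ℂ) (ρ : ℝ) :
    Real.circleAverage (fun z => f (c * z)) a ρ = Real.circleAverage f (c * a) (c * ρ) := by
  simp only [Real.circleAverage_def]
  congr 2
  ext θ
  congr 1
  simp only [circleMap]
  push_cast
  ring

theorem circleAverage_comp_unit_mul (f : ℂ → ℂ) {c : ℂ} (hc : ‖c‖ = 1) (a : ℂ) (ρ : ℝ) :
    Real.circleAverage (fun z => f (c * z)) a ρ = Real.circleAverage f (c * a) ρ := by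
  obtain ⟨η, rfl⟩ := (Complex.norm_eq_one_iff c).1 hc
  rw [Real.circleAverage_eq_integral_add (f := f) η, Real.circleAverage_def]
  congr 2
  ext θ
  congr 1
  simp only [circleMap]
  push_cast
  rw [add_mul, Complex.exp_add]
  ring

/-! ### The angular components with continuous radial part -/

/-- The radial factor `K` for which `conjPowMul n K` is the function
`z ↦ (z / |z|) ^ n * k (log |z|)` on `ℂ \ {0}`. -/
noncomputable def logProfile (n : ℕ) (k : ℝ → ℂ) (s : ℝ) : ℂ :=
  (√s : ℂ) ^ n * k (Real.log √s)

theorem conjPowMul_logProfile (n : ℕ) (k : ℝ → ℂ) {z : ℂ} (hz : z ≠ 0) :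
    conjPowMul n (logProfile n k) z = (z / ‖z‖) ^ n * k (Real.log ‖z‖) := by
  have h0 : (starRingEnd ℂ) z ≠ 0 := by simpa using hz
  have h1 : (‖z‖ : ℂ) ≠ 0 := by simpa using hz
  have h2 : ((starRingEnd ℂ) z)⁻¹ * ‖z‖ = z / ‖z‖ := by
    field_simp
    rw [← Complex.conj_mul', mul_comm]
  rw [conjPowMul, logProfile, Complex.normSq_eq_norm_sq, Real.sqrt_sq (norm_nonneg z), ← mul_assoc,
    ← mul_pow, h2]

theorem contDiffOn_logProfile (n m : ℕ) {k : ℝ → ℂ} (hk : ContDiff ℝ m k) :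
    ContDiffOn ℝ m (logProfile n k) (Ioi 0) := by
  intro s hs
  have h1 : ContDiffAt ℝ m (fun s : ℝ => √s) s := Real.contDiffAt_sqrt (ne_of_gt hs)
  have h2 : ContDiffAt ℝ m (fun s : ℝ => ((√s : ℝ) : ℂ)) s :=
    Complex.ofRealCLM.contDiff.contDiffAt.comp s h1
  have h3 : ContDiffAt ℝ m (fun s : ℝ => Real.log √s) s := h1.log (Real.sqrt_pos.2 hs).ne'
  exact ((h2.pow n).mul (hk.contDiffAt.comp s h3)).contDiffWithinAt

open ContinuousLinearMap MeasureTheory in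
/-- The vanishing of circle averages is invariant under dilations, hence survives smoothing in
the variable `log |z|`, on a slightly smaller annulus. -/
theorem circleAverage_conjPowMul_convolution (n : ℕ) {k : ℝ → ℂ} (hk : Continuous k) {r₁ r₂ : ℝ}
    (hr₁ : 0 < r₁)
    (h : ∀ (a : ℂ) (ρ : ℝ), r₁ ≤ ρ - ‖a‖ → ρ + ‖a‖ ≤ r₂ →
      Real.circleAverage (conjPowMul n (logProfile n k)) a ρ = 0)
    (χ : ContDiffBump (0 : ℝ)) (a : ℂ) (ρ : ℝ) (h₁ : r₁ * Real.exp χ.rOut < ρ - ‖a‖)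
    (h₂ : ρ + ‖a‖ < r₂ * Real.exp (-χ.rOut)) :
    Real.circleAverage (conjPowMul n
      (logProfile n (convolution (χ.normed volume) k (lsmul ℝ ℝ) volume))) a ρ = 0 := by
  have hpos : 0 < ρ - ‖a‖ := lt_trans (by positivity) h₁
  have hρ : 0 ≤ ρ := by linarith [norm_nonneg a]
  have hsph : sphere a ρ ⊆ ({0}ᶜ : Set ℂ) := by
    rintro z hz rfl
    simp only [mem_sphere, dist_zero_left] at hz
    linarith
  have hW : ContinuousOn (conjPowMul n (logProfile n k)) {0}ᶜ :=
    continuousOn_conjPowMul n (contDiffOn_logProfile n 0 (contDiff_zero.2 hk)).continuousOn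
  have hexp : ∀ t : ℝ, ((Real.exp (-t) : ℝ) : ℂ) ≠ 0 := fun t => by
    exact_mod_cast (Real.exp_pos _).ne'
  have hEq : EqOn (conjPowMul n
      (logProfile n (convolution (χ.normed volume) k (lsmul ℝ ℝ) volume)))
      (fun z => ∫ t in (-χ.rOut)..χ.rOut, (χ.normed volume t : ℂ) *
        conjPowMul n (logProfile n k) ((Real.exp (-t) : ℝ) * z)) (sphere a |ρ|) := by
    intro z hz
    rw [abs_of_nonneg hρ] at hz
    have hz0 : z ≠ 0 := hsph hz
    have hn0 : (‖z‖ : ℂ) ≠ 0 := by simpa using hz0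
    have e : ∀ t : ℝ, conjPowMul n (logProfile n k) ((Real.exp (-t) : ℝ) * z)
        = (z / ‖z‖) ^ n * k (Real.log ‖z‖ - t) := by
      intro t
      rw [conjPowMul_logProfile n k (mul_ne_zero (hexp t) hz0), norm_mul, Complex.norm_real,
        Real.norm_of_nonneg (Real.exp_pos _).le, Real.log_mul (Real.exp_pos _).ne'
        (norm_ne_zero_iff.2 hz0), Real.log_exp, Complex.ofReal_mul,
        mul_div_mul_left _ _ (hexp t), sub_eq_neg_add]
    simp only [e]
    rw [conjPowMul_logProfile n _ hz0, convolution_def,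
      ← intervalIntegral.integral_eq_integral_of_support_subset (a := -χ.rOut) (b := χ.rOut),
      ← intervalIntegral.integral_const_mul]
    · refine intervalIntegral.integral_congr fun t _ => ?_
      simp only [lsmul_apply, Complex.real_smul]
      ring
    · refine (Function.support_subset_iff'.2 fun t ht => ?_)
      have : χ.normed volume t = 0 := by
        have h3 : t ∉ Function.support (χ.normed volume) := by
          rw [χ.support_normed_eq, Real.ball_eq_Ioo]
          exact fun h => ht (Ioo_subset_Ioc_self (by simpa using h))
        simpa using h3
      simp [this]
  rw [Real.circleAverage_congr_sphere hEq, circleAverage_intervalIntegral_swap a ρ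
    (G := fun t z => (χ.normed volume t : ℂ) *
        conjPowMul n (logProfile n k) ((Real.exp (-t) : ℝ) * z))]
  · refine (intervalIntegral.integral_congr (g := fun _ => 0) fun t ht => ?_).trans (by simp)
    rw [uIcc_of_le (by linarith [χ.rOut_pos])] at ht
    have hn : ‖((Real.exp (-t) : ℝ) : ℂ) * a‖ = Real.exp (-t) * ‖a‖ := by
      rw [norm_mul, Complex.norm_real, Real.norm_of_nonneg (Real.exp_pos _).le]
    have hz : Real.circleAverage (conjPowMul n (logProfile n k)) ((Real.exp (-t) : ℝ) * a)
        (Real.exp (-t) * ρ) = 0 := by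
      refine h _ _ ?_ ?_
      · rw [hn, ← mul_sub]
        have h4 := Real.exp_le_exp.2 (neg_le_neg ht.2)
        calc r₁ = Real.exp (-χ.rOut) * (r₁ * Real.exp χ.rOut) := by
              rw [Real.exp_neg]; field_simp
          _ ≤ _ := mul_le_mul h4 h₁.le (by positivity) (Real.exp_pos _).le
      · rw [hn, ← mul_add]
        have h4 : Real.exp (-t) ≤ Real.exp χ.rOut := Real.exp_le_exp.2 (by linarith [ht.1])
        calc _ ≤ Real.exp χ.rOut * (r₂ * Real.exp (-χ.rOut)) :=
              mul_le_mul h4 h₂.le (by positivity) (Real.exp_pos _).le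
          _ = r₂ := by rw [Real.exp_neg]; field_simp
    have h5 := Real.circleAverage_fun_smul (a := (χ.normed volume t : ℂ))
      (f := fun z => conjPowMul n (logProfile n k) ((Real.exp (-t) : ℝ) * z)) (c := a) (R := ρ)
    simp only [smul_eq_mul] at h5
    rw [h5, circleAverage_comp_ofReal_mul (conjPowMul n (logProfile n k)), hz, mul_zero]
  · refine Continuous.mul ?_ (hW.comp_continuous ?_ ?_)
    · exact Complex.continuous_ofReal.comp (χ.continuous_normed.comp continuous_fst)
    · refine Continuous.mul (by fun_prop) ((continuous_circleMap a ρ).comp continuous_snd)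
    · intro p
      exact mul_ne_zero (hexp _) (hsph (circleMap_mem_sphere a hρ _))

open Filter Topology MeasureTheory in
/-- The classification of `exists_polynomial_of_contDiffOn` without smoothness: smoothing in
`log |z|` gives polynomials of bounded degree, and these are determined by their values at `n`
fixed nodes, which converge. -/
theorem exists_polynomial_of_continuous (n : ℕ) {k : ℝ → ℂ} (hk : Continuous k) {r₁ r₂ : ℝ}
    (hr₁ : 0 < r₁) (hr₂ : r₁ < r₂)
    (h : ∀ (a : ℂ) (ρ : ℝ), r₁ ≤ ρ - ‖a‖ → ρ + ‖a‖ ≤ r₂ →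
      Real.circleAverage (conjPowMul n (logProfile n k)) a ρ = 0) :
    ∃ p : Polynomial ℂ, p.degree < n ∧
      ∀ s ∈ Ioo (r₁ ^ 2) (r₂ ^ 2), logProfile n k s = p.eval (s : ℂ) := by
  have hlt : r₁ ^ 2 < r₂ ^ 2 := by gcongr
  obtain ⟨N, hNsub, hNcard⟩ := (Ioo_infinite hlt).exists_subset_card_eq n
  let v : ℝ → ℂ := fun s => s
  have hv : InjOn v N := fun x _ y _ hxy => Complex.ofReal_injective hxy
  refine ⟨Lagrange.interpolate N v (logProfile n k), ?_, fun s hs => ?_⟩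
  · simpa [hNcard] using Lagrange.degree_interpolate_lt (logProfile n k) hv
  let χ : ℕ → ContDiffBump (0 : ℝ) := fun i =>
    ⟨1 / (i + 1 : ℝ) / 2, 1 / (i + 1 : ℝ), by positivity, half_lt_self (by positivity)⟩
  have hχ : Tendsto (fun i => (χ i).rOut) atTop (𝓝 0) := tendsto_one_div_add_atTop_nhds_zero_nat
  let κ : ℕ → ℝ → ℂ := fun i => convolution ((χ i).normed volume) k
    (ContinuousLinearMap.lsmul ℝ ℝ) volume
  have hκ : ∀ x, Tendsto (fun i => κ i x) atTop (𝓝 (k x)) := fun x =>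
    ContDiffBump.convolution_tendsto_right_of_continuous hχ hk x
  have hprof : ∀ x, Tendsto (fun i => logProfile n (κ i) x) atTop (𝓝 (logProfile n k x)) :=
    fun x => (hκ _).const_mul _
  have hsmooth : ∀ i, ContDiff ℝ n (κ i) := fun i =>
    (χ i).hasCompactSupport_normed.contDiff_convolution_left _ (χ i).contDiff_normed
      hk.locallyIntegrable
  have hev : ∀ x ∈ Ioo (r₁ ^ 2) (r₂ ^ 2), ∀ᶠ i in atTop,
      x ∈ Ioo ((r₁ * Real.exp (χ i).rOut) ^ 2) ((r₂ * Real.exp (-(χ i).rOut)) ^ 2) := by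
    intro x hx
    have c1 : Continuous fun t : ℝ => (r₁ * Real.exp t) ^ 2 := by fun_prop
    have c2 : Continuous fun t : ℝ => (r₂ * Real.exp (-t)) ^ 2 := by fun_prop
    have t1 := (c1.tendsto 0).comp hχ
    have t2 := (c2.tendsto 0).comp hχ
    simp only [Real.exp_zero, neg_zero, mul_one] at t1 t2
    filter_upwards [t1.eventually_lt_const hx.1, t2.eventually_const_lt hx.2] with i h1 h2
    exact ⟨h1, h2⟩
  have heq : ∀ᶠ i in atTop, logProfile n (κ i) s
      = (Lagrange.interpolate N v (logProfile n (κ i))).eval (s : ℂ) := by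
    filter_upwards [hev s hs, (N.eventually_all).2 fun x hx => hev x (hNsub hx)] with i hi hN
    obtain ⟨p, hp, hpe⟩ := exists_polynomial_of_contDiffOn
      (r₁ := r₁ * Real.exp (χ i).rOut) (r₂ := r₂ * Real.exp (-(χ i).rOut))
      (by positivity) (mul_nonneg (hr₁.trans hr₂).le (Real.exp_pos _).le) n
      (logProfile n (κ i)) (contDiffOn_logProfile n n (hsmooth i))
      (circleAverage_conjPowMul_convolution n hk hr₁ h (χ i))
    rw [← Lagrange.eq_interpolate_of_eval_eq _ hv (by rwa [hNcard])
      fun x hx => (hpe x (hN x hx)).symm]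
    exact hpe s hi
  have hlim : Tendsto (fun i => (Lagrange.interpolate N v (logProfile n (κ i))).eval (s : ℂ)) atTop
      (𝓝 ((Lagrange.interpolate N v (logProfile n k)).eval (s : ℂ))) := by
    simp only [Lagrange.interpolate_apply, Polynomial.eval_finsetSum, Polynomial.eval_mul,
      Polynomial.eval_C]
    exact tendsto_finsetSum _ fun x _ => (hprof x).mul_const _
  exact tendsto_nhds_unique_of_eventuallyEq (hprof s) hlim heq

theorem isSurroundingCircleIn_of_le {r₁ r₂ : ℝ} (hr₁ : 0 < r₁) {a : ℂ} {ρ : ℝ} (h₁ : r₁ ≤ ρ - ‖a‖)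
    (h₂ : ρ + ‖a‖ ≤ r₂) : IsSurroundingCircleIn (closedAnnulus r₁ r₂) a ρ := by
  refine ⟨by linarith [norm_nonneg a], fun z hz => ?_, ?_⟩
  · rw [mem_sphere_iff_norm] at hz
    have h3 : ‖z‖ ≤ ‖z - a‖ + ‖a‖ := by simpa using norm_add_le (z - a) a
    exact ⟨by linarith [norm_sub_le z a], by linarith⟩
  · rw [mem_ball, dist_zero_left]
    linarith

/-- A continuous function of angular type `n` on the annulus, all of whose averages over
surrounding circles vanish, is a combination of the functions `z ^ i / z̄ ^ (n - i)`, `i < n`. -/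
theorem exists_polynomial_of_angular {r₁ r₂ : ℝ} (hr₁ : 0 < r₁) (hr₂ : r₁ < r₂) (n : ℕ) {F : ℂ → ℂ}
    (hF : ContinuousOn F (closedAnnulus r₁ r₂))
    (hrot : ∀ z ∈ closedAnnulus r₁ r₂, ∀ c : ℂ, ‖c‖ = 1 → F (c * z) = c ^ n * F z)
    (hmean : ∀ (a : ℂ) (ρ : ℝ), IsSurroundingCircleIn (closedAnnulus r₁ r₂) a ρ →
      Real.circleAverage F a ρ = 0) :
    ∃ p : Polynomial ℂ, p.degree < n ∧
      EqOn F (conjPowMul n fun s => p.eval (s : ℂ)) (closedAnnulus r₁ r₂) := by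
  -- The radial part in the variable `x = log r`, extended by constants to a continuous function.
  let k : ℝ → ℂ := fun x => F (Real.exp (max (Real.log r₁) (min x (Real.log r₂))) : ℝ)
  have hlog : Real.log r₁ ≤ Real.log r₂ := Real.log_le_log hr₁ hr₂.le
  have hk : Continuous k := by
    refine hF.comp_continuous (by fun_prop) fun x => ?_
    rw [closedAnnulus, mem_ofPred_eq, Complex.norm_real, Real.norm_of_nonneg (Real.exp_pos _).le]
    constructor
    · rw [← Real.log_le_iff_le_exp hr₁]
      exact le_max_left _ _
    · rw [← Real.le_log_iff_exp_le (hr₁.trans hr₂)]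
      exact max_le hlog (min_le_right _ _)
  have hne : ∀ z ∈ closedAnnulus r₁ r₂, z ≠ 0 := fun z hz =>
    norm_pos_iff.1 (hr₁.trans_le hz.1)
  have hFk : EqOn F (conjPowMul n (logProfile n k)) (closedAnnulus r₁ r₂) := by
    intro z hz
    have hz0 := hne z hz
    have hn : 0 < ‖z‖ := norm_pos_iff.2 hz0
    have hn' : (‖z‖ : ℂ) ≠ 0 := by exact_mod_cast hn.ne'
    have hk' : k (Real.log ‖z‖) = F ‖z‖ := by
      simp only [k]
      rw [min_eq_left (Real.log_le_log hn hz.2), max_eq_right (Real.log_le_log hr₁ hz.1),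
        Real.exp_log hn]
    rw [conjPowMul_logProfile n k hz0, hk', ← hrot _ (by simpa [closedAnnulus] using hz)]
    · rw [div_mul_cancel₀ _ hn']
    · rw [norm_div, Complex.norm_real, norm_norm, div_self hn.ne']
  obtain ⟨p, hp, hpe⟩ := exists_polynomial_of_continuous n hk hr₁ hr₂ fun a ρ h₁ h₂ => by
    have hs := isSurroundingCircleIn_of_le hr₁ h₁ h₂
    rw [← hmean a ρ hs]
    refine (Real.circleAverage_congr_sphere (hFk.mono ?_)).symm
    rw [abs_of_pos hs.1]
    exact hs.2.1
  have hlt : r₁ ^ 2 < r₂ ^ 2 := by gcongr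
  have hpe' : EqOn (logProfile n k) (fun s => p.eval (s : ℂ)) (Icc (r₁ ^ 2) (r₂ ^ 2)) := by
    refine EqOn.of_subset_closure (s := Ioo (r₁ ^ 2) (r₂ ^ 2)) hpe ?_ (by fun_prop)
      Ioo_subset_Icc_self (by rw [closure_Ioo hlt.ne])
    exact (contDiffOn_logProfile n 0 (contDiff_zero.2 hk)).continuousOn.mono
      fun s hs => (pow_pos hr₁ 2).trans_le hs.1
  refine ⟨p, hp, fun z hz => ?_⟩
  rw [hFk hz, conjPowMul, conjPowMul, hpe']
  rw [Complex.normSq_eq_norm_sq]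
  exact ⟨pow_le_pow_left₀ hr₁.le hz.1 2, pow_le_pow_left₀ (norm_nonneg z) hz.2 2⟩

/-! ### Extension to the disc -/

/-- The restriction of `h` to the circle with centre `a` and radius `ρ` has a continuous extension
to the closed disc which is holomorphic on the open disc and vanishes at the centre. -/
def ExtendsInsideVanishing (h : ℂ → ℂ) (a : ℂ) (ρ : ℝ) : Prop :=
  ∃ g : ℂ → ℂ, DiffContOnCl ℂ g (ball a ρ) ∧ g a = 0 ∧ EqOn g h (sphere a ρ)

theorem ExtendsInsideVanishing.congr {h₁ h₂ : ℂ → ℂ} {a : ℂ} {ρ : ℝ}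
    (h : ExtendsInsideVanishing h₁ a ρ) (he : EqOn h₁ h₂ (sphere a ρ)) :
    ExtendsInsideVanishing h₂ a ρ :=
  let ⟨g, hg, h0, hs⟩ := h
  ⟨g, hg, h0, hs.trans he⟩

theorem ExtendsInsideVanishing.sum {a : ℂ} {ρ : ℝ} {N : ℕ} {h : ℕ → ℂ → ℂ}
    (hh : ∀ i, ExtendsInsideVanishing (h i) a ρ) (c : ℕ → ℂ) :
    ExtendsInsideVanishing (fun z => ∑ i ∈ Finset.range N, c i * h i z) a ρ := by
  choose g hg h0 hs using hh
  refine ⟨fun z => ∑ i ∈ Finset.range N, c i * g i z, ⟨?_, ?_⟩, by simp [h0], fun z hz => ?_⟩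
  · exact DifferentiableOn.fun_sum fun i _ => (hg i).1.const_mul _
  · exact continuousOn_finsetSum _ fun i _ => continuousOn_const.mul (hg i).2
  · exact Finset.sum_congr rfl fun i _ => by rw [hs i hz]

open Filter Topology in
/-- By the maximum modulus principle, the class of functions that extend to the disc is closed
under uniform limits on the circle. -/
theorem ExtendsInsideVanishing.of_approx {F : ℂ → ℂ} {a : ℂ} {ρ : ℝ} (hρ : 0 < ρ)
    (happ : ∀ ε > 0, ∃ h, ExtendsInsideVanishing h a ρ ∧ ∀ z ∈ sphere a ρ, ‖F z - h z‖ ≤ ε) :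
    ExtendsInsideVanishing F a ρ := by
  have h1 : ∀ j : ℕ, ∃ g : ℂ → ℂ, DiffContOnCl ℂ g (ball a ρ) ∧ g a = 0 ∧
      ∀ z ∈ sphere a ρ, ‖F z - g z‖ ≤ 1 / (j + 1 : ℝ) := by
    intro j
    obtain ⟨h, ⟨g, hg, h0, hs⟩, hh⟩ := happ (1 / (j + 1 : ℝ)) (by positivity)
    exact ⟨g, hg, h0, fun z hz => by rw [hs hz]; exact hh z hz⟩
  choose g hg h0 hs using h1
  have hdiff : ∀ i j, ∀ z ∈ closedBall a ρ,
      ‖g i z - g j z‖ ≤ 1 / (i + 1 : ℝ) + 1 / (j + 1 : ℝ) := by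
    intro i j z hz
    refine Complex.norm_le_of_forall_mem_frontier_norm_le isBounded_ball ((hg i).sub (hg j)) ?_
      (by rwa [closure_ball a hρ.ne'])
    intro w hw
    rw [frontier_ball a hρ.ne'] at hw
    calc ‖g i w - g j w‖ = ‖(F w - g j w) - (F w - g i w)‖ := by ring_nf
      _ ≤ ‖F w - g j w‖ + ‖F w - g i w‖ := norm_sub_le _ _
      _ ≤ _ := by linarith [hs i w hw, hs j w hw]
  have hcauchy : UniformCauchySeqOn g atTop (closedBall a ρ) := by
    rw [Metric.uniformCauchySeqOn_iff]
    intro ε hε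
    obtain ⟨N, hN⟩ := exists_nat_one_div_lt (half_pos hε)
    refine ⟨N, fun m hm n hn z hz => ?_⟩
    rw [dist_eq_norm]
    have e1 := Nat.one_div_le_one_div (α := ℝ) hm
    have e2 := Nat.one_div_le_one_div (α := ℝ) hn
    linarith [hdiff m n z hz]
  have hlim : ∀ z, ∃ l, z ∈ closedBall a ρ → Tendsto (fun j => g j z) atTop (𝓝 l) := by
    intro z
    by_cases hz : z ∈ closedBall a ρ
    · obtain ⟨l, hl⟩ := cauchySeq_tendsto_of_complete (hcauchy.cauchySeq hz)
      exact ⟨l, fun _ => hl⟩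
    · exact ⟨0, fun h => absurd h hz⟩
  choose G hG using hlim
  have hunif : TendstoUniformlyOn g G atTop (closedBall a ρ) :=
    hcauchy.tendstoUniformlyOn_of_tendsto fun z hz => hG z hz
  refine ⟨G, ⟨?_, ?_⟩, ?_, fun z hz => ?_⟩
  · exact (hunif.mono ball_subset_closedBall).tendstoLocallyUniformlyOn.differentiableOn
      (Eventually.of_forall fun j => (hg j).1) isOpen_ball
  · rw [closure_ball a hρ.ne']
    exact hunif.continuousOn (Frequently.of_forall fun j => by
      simpa [closure_ball a hρ.ne'] using (hg j).2)
  · refine tendsto_nhds_unique (hG a (mem_closedBall_self hρ.le)) ?_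
    simp [h0]
  · refine tendsto_nhds_unique (hG z (sphere_subset_closedBall hz)) ?_
    rw [tendsto_iff_norm_sub_tendsto_zero]
    refine squeeze_zero (fun _ => norm_nonneg _) (fun j => ?_)
      (tendsto_one_div_add_atTop_nhds_zero_nat (𝕜 := ℝ))
    rw [norm_sub_rev]
    exact hs j z hz

/-- On a circle surrounding the origin, `1 / z̄` is the restriction of the function
`(z - a) / (ā (z - a) + ρ²)`, which is holomorphic on the disc and vanishes at its centre. Hence
so do all `z ^ i / z̄ ^ (n - i)` with `i < n`. -/
theorem extendsInsideVanishing_conjPowMul {a : ℂ} {ρ : ℝ} (ha : ‖a‖ < ρ) {n : ℕ} {p : Polynomial ℂ}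
    (hp : p.degree < n) :
    ExtendsInsideVanishing (conjPowMul n fun s => p.eval (s : ℂ)) a ρ := by
  have hρ : 0 < ρ := (norm_nonneg a).trans_lt ha
  let Q : ℂ → ℂ := fun z => (starRingEnd ℂ) a * (z - a) + ρ ^ 2
  let B : ℂ → ℂ := fun z => (z - a) / Q z
  have hQ : ∀ z ∈ closedBall a ρ, Q z ≠ 0 := by
    intro z hz h
    rw [mem_closedBall_iff_norm] at hz
    have h1 : ‖(starRingEnd ℂ) a * (z - a)‖ = ρ ^ 2 := by
      rw [eq_neg_of_add_eq_zero_left h, norm_neg, norm_pow, Complex.norm_real,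
        Real.norm_of_nonneg hρ.le]
    rw [norm_mul, RCLike.norm_conj] at h1
    nlinarith [norm_nonneg a, norm_nonneg (z - a)]
  have hB : DiffContOnCl ℂ B (ball a ρ) := by
    refine DifferentiableOn.diffContOnCl ?_
    rw [closure_ball a hρ.ne']
    exact DifferentiableOn.div (by fun_prop) (by fun_prop) hQ
  have hBs : ∀ z ∈ sphere a ρ, B z = ((starRingEnd ℂ) z)⁻¹ ∧ (starRingEnd ℂ) z ≠ 0 := by
    intro z hz
    have hQz : Q z = (z - a) * (starRingEnd ℂ) z := by
      have : (z - a) * (starRingEnd ℂ) (z - a) = ρ ^ 2 := by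
        rw [Complex.mul_conj', mem_sphere_iff_norm.1 hz]
      simp only [Q]
      rw [← this, map_sub]
      ring
    have h0 := hQ z (sphere_subset_closedBall hz)
    rw [hQz] at h0
    refine ⟨?_, right_ne_zero_of_mul h0⟩
    simp only [B]
    rw [hQz, div_mul_eq_div_div, div_self (left_ne_zero_of_mul h0), one_div]
  refine ⟨fun z => ∑ i ∈ Finset.range n, p.coeff i * z ^ i * B z ^ (n - i), ⟨?_, ?_⟩, ?_, ?_⟩
  · exact DifferentiableOn.fun_sum fun i _ =>
      DifferentiableOn.mul (by fun_prop) (hB.1.pow _)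
  · exact continuousOn_finsetSum _ fun i _ => ContinuousOn.mul (by fun_prop) (hB.2.pow _)
  · refine Finset.sum_eq_zero fun i hi => ?_
    have : n - i ≠ 0 := Nat.sub_ne_zero_of_lt (Finset.mem_range.1 hi)
    simp [B, this]
  · intro z hz
    obtain ⟨h1, h2⟩ := hBs z hz
    have heval : ∀ x : ℂ, p.eval x = ∑ i ∈ Finset.range n, p.coeff i * x ^ i := by
      intro x
      by_cases h0 : p = 0
      · simp [h0]
      · exact Polynomial.eval_eq_sum_range' ((Polynomial.natDegree_lt_iff_degree_lt h0).2 hp) x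
    simp only [conjPowMul, heval, Finset.mul_sum, h1]
    refine Finset.sum_congr rfl fun i hi => ?_
    have hsplit : ((starRingEnd ℂ) z)⁻¹ ^ n
        = ((starRingEnd ℂ) z)⁻¹ ^ (n - i) * ((starRingEnd ℂ) z)⁻¹ ^ i := by
      rw [← pow_add, Nat.sub_add_cancel (Finset.mem_range.1 hi).le]
    have hone : ((starRingEnd ℂ) z)⁻¹ ^ i * ((starRingEnd ℂ) z) ^ i = 1 := by
      rw [← mul_pow, inv_mul_cancel₀ h2, one_pow]
    rw [← Complex.mul_conj, mul_pow, hsplit]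
    linear_combination (-(p.coeff i * z ^ i * ((starRingEnd ℂ) z)⁻¹ ^ (n - i))) * hone

/-! ### The Cauchy projection on centred circles -/

theorem norm_circleAverage_le {g : ℂ → ℂ} {b : ℂ → ℝ} {a : ℂ} {ρ : ℝ} (hb : CircleIntegrable b a ρ)
    (h : ∀ z ∈ sphere a |ρ|, ‖g z‖ ≤ b z) :
    ‖Real.circleAverage g a ρ‖ ≤ Real.circleAverage b a ρ := by
  rw [Real.circleAverage_def, Real.circleAverage_def, norm_smul, smul_eq_mul,
    Real.norm_of_nonneg (inv_nonneg.2 Real.two_pi_pos.le)]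
  refine mul_le_mul_of_nonneg_left ?_ (inv_nonneg.2 Real.two_pi_pos.le)
  exact intervalIntegral.norm_integral_le_of_norm_le Real.two_pi_pos.le
    (Filter.Eventually.of_forall fun θ _ => h _ (circleMap_mem_sphere' a ρ θ)) hb

/-- On the unit circle `|1 - e^{iθ}| = 2 |sin (θ / 2)|` is at least half the distance from `θ` to the
nearer endpoint of `[0, 2π]`, and `θ ^ (γ - 1)` is integrable at `0`. -/
theorem circleIntegrable_norm_one_sub_rpow {γ : ℝ} (h₀ : 0 < γ) (h₁ : γ ≤ 1) :
    CircleIntegrable (fun u : ℂ => ‖1 - u‖ ^ (γ - 1)) 0 1 := by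
  have i1 : IntervalIntegrable (fun θ : ℝ => (θ / 2) ^ (γ - 1)) MeasureTheory.volume 0
      (2 * Real.pi) := by
    have := IntervalIntegrable.comp_mul_right (intervalIntegral.intervalIntegrable_rpow' (a := 0)
      (b := Real.pi) (r := γ - 1) (by linarith)) (c := 2⁻¹)
    simpa [mul_comm, div_eq_mul_inv] using this
  have i2 : IntervalIntegrable (fun θ : ℝ => ((2 * Real.pi - θ) / 2) ^ (γ - 1))
      MeasureTheory.volume 0 (2 * Real.pi) := by
    have := (i1.comp_sub_left (2 * Real.pi)).symm
    simpa using this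
  refine (i1.add i2).mono_fun' ?_ ?_
  · have : Continuous fun θ : ℝ => ‖1 - circleMap 0 1 θ‖ := by fun_prop
    exact (this.measurable.pow_const _).aestronglyMeasurable
  · rw [uIoc_of_le Real.two_pi_pos.le]
    refine (MeasureTheory.ae_restrict_mem measurableSet_Ioc).mono fun θ hθ => ?_
    have hnorm : ‖1 - circleMap 0 1 θ‖ = 2 * Real.sin (θ / 2) := by
      have h2 : 0 ≤ Real.sin (θ / 2) :=
        Real.sin_nonneg_of_nonneg_of_le_pi (by linarith [hθ.1]) (by linarith [hθ.2])
      rw [norm_sub_rev, circleMap, zero_add, Complex.ofReal_one, one_mul, mul_comm,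
        Complex.norm_exp_I_mul_ofReal_sub_one, Real.norm_of_nonneg (by linarith)]
    have hπ : 1 ≤ 4 / Real.pi := by
      rw [one_le_div Real.pi_pos]; exact Real.pi_le_four
    simp only [hnorm]
    rw [Real.norm_of_nonneg (Real.rpow_nonneg (by rw [← hnorm]; positivity) _)]
    have p1 : 0 ≤ (θ / 2) ^ (γ - 1) := Real.rpow_nonneg (by linarith [hθ.1]) _
    have p2 : 0 ≤ ((2 * Real.pi - θ) / 2) ^ (γ - 1) := Real.rpow_nonneg (by linarith [hθ.2]) _
    rcases le_total θ Real.pi with h | h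
    · have h3 := Real.mul_le_sin (x := θ / 2) (by linarith [hθ.1]) (by linarith)
      have h4 : θ / 2 ≤ 2 * Real.sin (θ / 2) := by
        have : θ / 2 ≤ (4 / Real.pi) * (θ / 2) := by nlinarith [hθ.1]
        have e : (4 / Real.pi) * (θ / 2) = 2 * (2 / Real.pi * (θ / 2)) := by ring
        linarith
      have := Real.rpow_le_rpow_of_nonpos (by linarith [hθ.1]) h4 (by linarith : γ - 1 ≤ 0)
      linarith
    · rcases hθ.2.eq_or_lt with rfl | hlt
      · have : 2 * Real.pi / 2 = Real.pi := by ring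
        rw [this, Real.sin_pi, sub_self, zero_div, mul_zero]
        rw [this] at p1
        linarith
      have h3 := Real.mul_le_sin (x := Real.pi - θ / 2) (by linarith [hθ.2]) (by linarith)
      rw [Real.sin_pi_sub] at h3
      have h4 : (2 * Real.pi - θ) / 2 ≤ 2 * Real.sin (θ / 2) := by
        have : Real.pi - θ / 2 ≤ (4 / Real.pi) * (Real.pi - θ / 2) := by nlinarith [hθ.2]
        have e : (4 / Real.pi) * (Real.pi - θ / 2) = 2 * (2 / Real.pi * (Real.pi - θ / 2)) := by
          ring
        linarith
      have := Real.rpow_le_rpow_of_nonpos (by linarith) h4 (by linarith : γ - 1 ≤ 0)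
      linarith

theorem inv_mul_mem_closedAnnulus {r₁ r₂ : ℝ} {z u : ℂ} (hz : z ∈ closedAnnulus r₁ r₂)
    (hu : ‖u‖ = 1) : u⁻¹ * z ∈ closedAnnulus r₁ r₂ := by
  simpa [closedAnnulus, hu] using hz

theorem circleMap_mem_closedAnnulus {r₁ r₂ : ℝ} {z : ℂ} (hz : z ∈ closedAnnulus r₁ r₂) (θ : ℝ) :
    (circleMap 0 1 θ)⁻¹ * z ∈ closedAnnulus r₁ r₂ :=
  inv_mul_mem_closedAnnulus hz (by simp)

theorem continuous_comp_circleMap_inv_mul {r₁ r₂ : ℝ} {f : ℂ → ℂ}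
    (hf : ContinuousOn f (closedAnnulus r₁ r₂)) {z : ℂ} (hz : z ∈ closedAnnulus r₁ r₂) :
    Continuous fun θ : ℝ => f ((circleMap 0 1 θ)⁻¹ * z) := by
  refine hf.comp_continuous (Continuous.mul ?_ continuous_const) fun θ =>
    circleMap_mem_closedAnnulus hz θ
  exact (continuous_circleMap 0 1).inv₀ fun θ => circleMap_ne_center one_ne_zero

/-- The `n`-th angular Fourier component of `f`: it maps `r e ^ (i φ)` to
`f_n(r) e ^ (i n φ)`, where `f_n(r)` is the `n`-th Fourier coefficient of `f` on the circle
`|z| = r`. -/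
noncomputable def angularPart (n : ℕ) (f : ℂ → ℂ) (z : ℂ) : ℂ :=
  Real.circleAverage (fun u => u ^ n * f (u⁻¹ * z)) 0 1

/-- The Abel mean of the nonnegative part of the angular Fourier series of `f`, that is,
the sum of `t ^ n * angularPart n f` over all `n`. -/
noncomputable def abelMean (t : ℝ) (f : ℂ → ℂ) (z : ℂ) : ℂ :=
  Real.circleAverage (fun u => (1 - t * u)⁻¹ * f (u⁻¹ * z)) 0 1

/-- The projection of `f`, on each circle centred at the origin, to the nonnegative part of its
Fourier series. It is written as a Cauchy integral whose singularity is removed by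
subtracting `f z`. -/
noncomputable def cauchyProjection (f : ℂ → ℂ) (z : ℂ) : ℂ :=
  f z + Real.circleAverage (fun u => (1 - u)⁻¹ * (f (u⁻¹ * z) - f z)) 0 1

theorem norm_one_sub_mul_ge {t : ℝ} (h₀ : 0 ≤ t) {u : ℂ} (hu : ‖u‖ = 1) :
    1 - t ≤ ‖1 - t * u‖ := by
  have := norm_sub_norm_le (1 : ℂ) (t * u)
  simpa [hu, abs_of_nonneg h₀] using this

theorem one_sub_mul_ne_zero {t : ℝ} (h₀ : 0 ≤ t) (h₁ : t < 1) {u : ℂ} (hu : ‖u‖ = 1) :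
    1 - t * u ≠ 0 :=
  norm_pos_iff.1 ((sub_pos.2 h₁).trans_le (norm_one_sub_mul_ge h₀ hu))

theorem norm_one_sub_le {t : ℝ} (h₀ : 0 ≤ t) (h₁ : t < 1) {u : ℂ} (hu : ‖u‖ = 1) :
    ‖1 - u‖ ≤ 2 * ‖1 - t * u‖ := by
  have e : 1 - u = (1 - t * u) - ((1 - t : ℝ) : ℂ) * u := by push_cast; ring
  have h2 : ‖1 - u‖ ≤ ‖1 - t * u‖ + (1 - t) := by
    rw [e]
    refine (norm_sub_le _ _).trans_eq ?_
    rw [norm_mul, hu, Complex.norm_real, Real.norm_of_nonneg (by linarith), mul_one]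
  linarith [norm_one_sub_mul_ge h₀ hu]

theorem continuous_inv_one_sub_mul_circleMap {t : ℝ} (h₀ : 0 ≤ t) (h₁ : t < 1) :
    Continuous fun θ : ℝ => (1 - t * circleMap 0 1 θ)⁻¹ :=
  Continuous.inv₀ (by fun_prop) fun θ => one_sub_mul_ne_zero h₀ h₁ (by simp)

theorem circleAverage_inv_one_sub_mul {t : ℝ} (h₀ : 0 ≤ t) (h₁ : t < 1) :
    Real.circleAverage (fun u => (1 - t * u)⁻¹) 0 1 = 1 := by
  have hd : DiffContOnCl ℂ (fun u : ℂ => (1 - t * u)⁻¹) (ball 0 |1|) := by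
    refine DifferentiableOn.diffContOnCl (DifferentiableOn.inv (by fun_prop) ?_)
    intro u hu h
    rw [abs_one, closure_ball _ one_ne_zero, mem_closedBall_zero_iff] at hu
    have h2 : ‖(t : ℂ) * u‖ = 1 := by rw [← sub_eq_zero.1 h, norm_one]
    rw [norm_mul, Complex.norm_real, Real.norm_of_nonneg h₀] at h2
    nlinarith [norm_nonneg u]
  rw [hd.circleAverage]
  simp

theorem circleIntegrable_abelMean {r₁ r₂ : ℝ} {f : ℂ → ℂ}
    (hf : ContinuousOn f (closedAnnulus r₁ r₂)) {t : ℝ} (h₀ : 0 ≤ t) (h₁ : t < 1) {z : ℂ}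
    (hz : z ∈ closedAnnulus r₁ r₂) :
    CircleIntegrable (fun u => (1 - t * u)⁻¹ * f (u⁻¹ * z)) 0 1 :=
  ((continuous_inv_one_sub_mul_circleMap h₀ h₁).mul
    (continuous_comp_circleMap_inv_mul hf hz)).intervalIntegrable _ _

theorem abelMean_eq {r₁ r₂ : ℝ} {f : ℂ → ℂ}
    (hf : ContinuousOn f (closedAnnulus r₁ r₂)) {t : ℝ} (h₀ : 0 ≤ t) (h₁ : t < 1) {z : ℂ}
    (hz : z ∈ closedAnnulus r₁ r₂) :
    abelMean t f z
      = f z + Real.circleAverage (fun u => (1 - t * u)⁻¹ * (f (u⁻¹ * z) - f z)) 0 1 := by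
  have hc : CircleIntegrable (fun u => (1 - t * u)⁻¹ * f z) 0 1 :=
    ((continuous_inv_one_sub_mul_circleMap h₀ h₁).mul continuous_const).intervalIntegrable _ _
  have e : Real.circleAverage (fun u => (1 - t * u)⁻¹ * f z) 0 1 = f z := by
    have := Real.circleAverage_fun_smul (a := f z) (f := fun u : ℂ => (1 - t * u)⁻¹) (c := 0)
      (R := 1)
    simp only [smul_eq_mul, circleAverage_inv_one_sub_mul h₀ h₁, mul_one] at this
    simpa only [mul_comm] using this
  simp only [mul_sub]
  rw [Real.circleAverage_fun_sub (circleIntegrable_abelMean hf h₀ h₁ hz) hc, e, abelMean]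
  ring

theorem norm_rotate_sub_le {r₁ r₂ M α : ℝ} {f : ℂ → ℂ} (hM : 0 ≤ M) (hα : 0 < α)
    (hH : ∀ z ∈ closedAnnulus r₁ r₂, ∀ w ∈ closedAnnulus r₁ r₂, ‖f z - f w‖ ≤ M * ‖z - w‖ ^ α)
    {z u : ℂ} (hz : z ∈ closedAnnulus r₁ r₂) (hu : ‖u‖ = 1) :
    ‖f (u⁻¹ * z) - f z‖ ≤ M * r₂ ^ α * ‖1 - u‖ ^ α := by
  have hu0 : u ≠ 0 := norm_pos_iff.1 (by rw [hu]; exact one_pos)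
  have e : ‖u⁻¹ * z - z‖ = ‖z‖ * ‖1 - u‖ := by
    have : u⁻¹ * z - z = u⁻¹ * (z * (1 - u)) := by field_simp
    rw [this, norm_mul, norm_inv, hu, inv_one, one_mul, norm_mul]
  have h1 : ‖u⁻¹ * z - z‖ ≤ r₂ * ‖1 - u‖ := by
    rw [e]; exact mul_le_mul_of_nonneg_right hz.2 (norm_nonneg _)
  calc _ ≤ M * ‖u⁻¹ * z - z‖ ^ α := hH _ (inv_mul_mem_closedAnnulus hz hu) _ hz
    _ ≤ M * (r₂ * ‖1 - u‖) ^ α := by gcongr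
    _ = _ := by rw [Real.mul_rpow ((norm_nonneg z).trans hz.2) (norm_nonneg _), mul_assoc]

theorem circleIntegrable_cauchyProjection {r₁ r₂ M α : ℝ} {f : ℂ → ℂ}
    (hM : 0 ≤ M) (hα : 0 < α) (hα₁ : α < 1) (hf : ContinuousOn f (closedAnnulus r₁ r₂))
    (hH : ∀ z ∈ closedAnnulus r₁ r₂, ∀ w ∈ closedAnnulus r₁ r₂, ‖f z - f w‖ ≤ M * ‖z - w‖ ^ α)
    {z : ℂ} (hz : z ∈ closedAnnulus r₁ r₂) :
    CircleIntegrable (fun u => (1 - u)⁻¹ * (f (u⁻¹ * z) - f z)) 0 1 := by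
  refine IntervalIntegrable.mono_fun'
    ((circleIntegrable_norm_one_sub_rpow hα hα₁.le).const_smul (a := M * r₂ ^ α)) ?_
    (Filter.Eventually.of_forall fun θ => ?_)
  · refine MeasureTheory.AEStronglyMeasurable.mul ?_
      ((continuous_comp_circleMap_inv_mul hf hz).sub continuous_const).aestronglyMeasurable
    have : Continuous fun θ : ℝ => 1 - circleMap 0 1 θ := by fun_prop
    exact this.measurable.inv.aestronglyMeasurable
  · have hu : ‖circleMap 0 1 θ‖ = 1 := by simp
    have h1 := norm_rotate_sub_le hM hα hH hz hu
    have hr₂ : 0 ≤ r₂ := (norm_nonneg z).trans hz.2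
    simp only [Pi.smul_apply, smul_eq_mul]
    rw [norm_mul, norm_inv]
    rcases (norm_nonneg (1 - circleMap 0 1 θ)).eq_or_lt with h | h
    · rw [← h, inv_zero, zero_mul]
      positivity
    · rw [Real.rpow_sub_one h.ne', div_eq_inv_mul, mul_left_comm]
      exact mul_le_mul_of_nonneg_left h1 (by positivity)

/-- The Abel means converge uniformly to the Cauchy projection, with a rate. -/
theorem exists_norm_abelMean_sub_le {r₁ r₂ M α : ℝ} {f : ℂ → ℂ} (hr₂ : 0 ≤ r₂)
    (hM : 0 ≤ M) (hα : 0 < α) (hα₁ : α < 1) (hf : ContinuousOn f (closedAnnulus r₁ r₂))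
    (hH : ∀ z ∈ closedAnnulus r₁ r₂, ∀ w ∈ closedAnnulus r₁ r₂, ‖f z - f w‖ ≤ M * ‖z - w‖ ^ α) :
    ∃ C : ℝ, 0 ≤ C ∧ ∀ t : ℝ, 0 ≤ t → t < 1 → ∀ z ∈ closedAnnulus r₁ r₂,
      ‖abelMean t f z - cauchyProjection f z‖ ≤ C * (1 - t) ^ (α / 2) := by
  set J := Real.circleAverage (fun u : ℂ => ‖1 - u‖ ^ (α / 2 - 1)) 0 1 with hJ
  have hJ0 : 0 ≤ J := Real.circleAverage_nonneg_of_nonneg fun u _ => by positivity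
  refine ⟨2 * M * r₂ ^ α * J, by positivity, fun t h₀ h₁ z hz => ?_⟩
  have hint : CircleIntegrable (fun u => (1 - t * u)⁻¹ * (f (u⁻¹ * z) - f z)) 0 1 :=
    ((continuous_inv_one_sub_mul_circleMap h₀ h₁).mul
      ((continuous_comp_circleMap_inv_mul hf hz).sub continuous_const)).intervalIntegrable _ _
  have hδ : 0 < 1 - t := by linarith
  rw [abelMean_eq hf h₀ h₁ hz, cauchyProjection, add_sub_add_left_eq_sub,
    ← Real.circleAverage_fun_sub hint
      (circleIntegrable_cauchyProjection hM hα hα₁ hf hH hz)]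
  have hb := (circleIntegrable_norm_one_sub_rpow (half_pos hα) (by linarith)).const_smul
    (a := 2 * M * r₂ ^ α * (1 - t) ^ (α / 2))
  refine (norm_circleAverage_le hb fun u hu => ?_).trans_eq ?_
  · rw [abs_one, mem_sphere_zero_iff_norm] at hu
    simp only [Pi.smul_apply, smul_eq_mul]
    -- At `u = 1` the factor `(1 - u)⁻¹` is `0`, but there `f (u⁻¹ z) - f z` vanishes as well.
    rcases eq_or_ne u 1 with rfl | hu1
    · simp only [inv_one, one_mul, sub_self, mul_zero, norm_zero]
      positivity
    have hx : 0 < ‖1 - u‖ := norm_pos_iff.2 (sub_ne_zero.2 hu1.symm)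
    have hy : 0 < ‖1 - t * u‖ := norm_pos_iff.2 (one_sub_mul_ne_zero h₀ h₁ hu)
    have hxy := norm_one_sub_le h₀ h₁ hu
    have hδy := norm_one_sub_mul_ge h₀ hu
    have e1 : (1 - t * u)⁻¹ - (1 - u)⁻¹ = -((1 - t : ℝ) * u) * (1 - t * u)⁻¹ * (1 - u)⁻¹ := by
      have := norm_pos_iff.1 hx
      have := norm_pos_iff.1 hy
      field_simp
      push_cast
      ring
    have e2 : ‖(1 - t * u)⁻¹ - (1 - u)⁻¹‖ = (1 - t) / ‖1 - t * u‖ * ‖1 - u‖⁻¹ := by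
      rw [e1, norm_mul, norm_mul, norm_neg, norm_mul, hu, norm_inv, norm_inv, Complex.norm_real,
        Real.norm_of_nonneg hδ.le, mul_one, div_eq_mul_inv]
    -- Half of the exponent `α` pays for the rate, the other half keeps the kernel integrable.
    have h2 : (1 - t) / ‖1 - t * u‖ ≤ 2 * ((1 - t) ^ (α / 2) / ‖1 - u‖ ^ (α / 2)) := by
      calc (1 - t) / ‖1 - t * u‖ = ((1 - t) / ‖1 - t * u‖) ^ (1 : ℝ) := (Real.rpow_one _).symm
        _ ≤ ((1 - t) / ‖1 - t * u‖) ^ (α / 2) :=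
            Real.rpow_le_rpow_of_exponent_ge (by positivity) ((div_le_one hy).2 hδy) (by linarith)
        _ ≤ (2 * ((1 - t) / ‖1 - u‖)) ^ (α / 2) := by
            refine Real.rpow_le_rpow (by positivity) ?_ (by positivity)
            rw [← mul_div_assoc, div_le_div_iff₀ hy hx]
            nlinarith
        _ = 2 ^ (α / 2) * ((1 - t) ^ (α / 2) / ‖1 - u‖ ^ (α / 2)) := by
            rw [Real.mul_rpow (by norm_num) (by positivity), Real.div_rpow hδ.le hx.le]
        _ ≤ 2 * ((1 - t) ^ (α / 2) / ‖1 - u‖ ^ (α / 2)) := by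
            refine mul_le_mul_of_nonneg_right ?_ (by positivity)
            simpa using Real.rpow_le_rpow_of_exponent_le (x := 2) (by norm_num)
              (by linarith : α / 2 ≤ 1)
    rw [← sub_mul, norm_mul, e2]
    have hsplit : ‖1 - u‖ ^ α = ‖1 - u‖ ^ (α / 2) * ‖1 - u‖ ^ (α / 2) := by
      rw [← Real.rpow_add hx, add_halves]
    have hpos : 0 < ‖1 - u‖ ^ (α / 2) := Real.rpow_pos_of_pos hx _
    calc _ ≤ 2 * ((1 - t) ^ (α / 2) / ‖1 - u‖ ^ (α / 2)) * ‖1 - u‖⁻¹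
          * (M * r₂ ^ α * ‖1 - u‖ ^ α) :=
          mul_le_mul (mul_le_mul_of_nonneg_right h2 (by positivity))
            (norm_rotate_sub_le hM hα hH hz hu) (norm_nonneg _) (by positivity)
      _ = _ := by
          rw [hsplit, Real.rpow_sub_one hx.ne']
          field_simp
  · have := Real.circleAverage_smul (a := 2 * M * r₂ ^ α * (1 - t) ^ (α / 2))
      (f := fun u : ℂ => ‖1 - u‖ ^ (α / 2 - 1)) (c := 0) (R := 1)
    rw [this, smul_eq_mul, ← hJ]
    ring

theorem norm_abelMean_sub_abelMean_le {r₁ r₂ M α : ℝ} {f : ℂ → ℂ}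
    (hf : ContinuousOn f (closedAnnulus r₁ r₂))
    (hH : ∀ z ∈ closedAnnulus r₁ r₂, ∀ w ∈ closedAnnulus r₁ r₂, ‖f z - f w‖ ≤ M * ‖z - w‖ ^ α)
    {t : ℝ} (h₀ : 0 ≤ t) (h₁ : t < 1) {z w : ℂ} (hz : z ∈ closedAnnulus r₁ r₂)
    (hw : w ∈ closedAnnulus r₁ r₂) :
    ‖abelMean t f z - abelMean t f w‖ ≤ M * ‖z - w‖ ^ α / (1 - t) := by
  have hδ : 0 < 1 - t := by linarith
  rw [abelMean, abelMean, ← Real.circleAverage_fun_sub (circleIntegrable_abelMean hf h₀ h₁ hz)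
    (circleIntegrable_abelMean hf h₀ h₁ hw),
    ← Real.circleAverage_const (M * ‖z - w‖ ^ α / (1 - t)) 0 1]
  refine norm_circleAverage_le (circleIntegrable_const _ _ _) fun u hu => ?_
  rw [abs_one, mem_sphere_zero_iff_norm] at hu
  have h2 := hH _ (inv_mul_mem_closedAnnulus hz hu) _ (inv_mul_mem_closedAnnulus hw hu)
  rw [← mul_sub u⁻¹, norm_mul, norm_inv, hu, inv_one, one_mul] at h2
  rw [← mul_sub, norm_mul, norm_inv, div_eq_inv_mul]
  exact mul_le_mul (inv_anti₀ hδ (norm_one_sub_mul_ge h₀ hu)) h2 (norm_nonneg _) (by positivity)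

/-- Privalov's theorem on the annulus: the Cauchy projection preserves Hölder continuity, though
not necessarily with the same exponent. The Abel mean with
`1 - t = |z - w| ^ (α / 2)` is compared with the projection at `z` and at `w`. -/
theorem exists_norm_cauchyProjection_sub_le {r₁ r₂ M α : ℝ} {f : ℂ → ℂ} (hr₂ : 0 ≤ r₂)
    (hM : 0 ≤ M) (hα : 0 < α) (hα₁ : α < 1) (hf : ContinuousOn f (closedAnnulus r₁ r₂))
    (hH : ∀ z ∈ closedAnnulus r₁ r₂, ∀ w ∈ closedAnnulus r₁ r₂, ‖f z - f w‖ ≤ M * ‖z - w‖ ^ α) :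
    ∃ C : ℝ, 0 ≤ C ∧ ∀ z ∈ closedAnnulus r₁ r₂, ∀ w ∈ closedAnnulus r₁ r₂,
      ‖cauchyProjection f z - cauchyProjection f w‖ ≤ C * ‖z - w‖ ^ (α ^ 2 / 4) := by
  obtain ⟨C, hC0, hC⟩ := exists_norm_abelMean_sub_le hr₂ hM hα hα₁ hf hH
  -- The last summand covers `|z - w| ≥ 1`, where `|z - w| ≤ 2 r₂`.
  refine ⟨2 * C + M + M * (2 * r₂) ^ α, by positivity, fun z hz w hw => ?_⟩
  have key : ∀ δ : ℝ, 0 < δ → δ ≤ 1 → ‖cauchyProjection f z - cauchyProjection f w‖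
      ≤ 2 * (C * δ ^ (α / 2)) + M * ‖z - w‖ ^ α / δ := by
    intro δ h₀ h₁
    have a1 := hC (1 - δ) (by linarith) (by linarith) z hz
    have a2 := hC (1 - δ) (by linarith) (by linarith) w hw
    have a3 := norm_abelMean_sub_abelMean_le hf hH (t := 1 - δ) (by linarith) (by linarith) hz hw
    rw [sub_sub_cancel] at a1 a2 a3
    calc ‖cauchyProjection f z - cauchyProjection f w‖
        = ‖(abelMean (1 - δ) f z - abelMean (1 - δ) f w)
          - (abelMean (1 - δ) f z - cauchyProjection f z)
          + (abelMean (1 - δ) f w - cauchyProjection f w)‖ := by ring_nf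
      _ ≤ _ := (norm_add_le _ _).trans (add_le_add (norm_sub_le _ _) le_rfl)
      _ ≤ _ := by linarith
  rcases eq_or_ne z w with rfl | hne
  · rw [sub_self, norm_zero]; positivity
  have hd : 0 < ‖z - w‖ := norm_pos_iff.2 (sub_ne_zero.2 hne)
  have hdp : 0 < ‖z - w‖ ^ (α ^ 2 / 4) := Real.rpow_pos_of_pos hd _
  have hR : 0 ≤ M * (2 * r₂) ^ α := by positivity
  rcases le_total ‖z - w‖ 1 with h1 | h1
  · have k1 := key (‖z - w‖ ^ (α / 2)) (Real.rpow_pos_of_pos hd _)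
      (Real.rpow_le_one hd.le h1 (by positivity))
    rw [← Real.rpow_mul hd.le, mul_div_assoc, ← Real.rpow_sub hd] at k1
    have e1 : α / 2 * (α / 2) = α ^ 2 / 4 := by ring
    have e2 : ‖z - w‖ ^ (α - α / 2) ≤ ‖z - w‖ ^ (α ^ 2 / 4) :=
      Real.rpow_le_rpow_of_exponent_ge hd h1 (by nlinarith)
    rw [e1] at k1
    have e3 := mul_le_mul_of_nonneg_left e2 hM
    nlinarith
  · have k1 := key 1 one_pos le_rfl
    rw [Real.one_rpow, div_one, mul_one] at k1
    have e1 : 1 ≤ ‖z - w‖ ^ (α ^ 2 / 4) := Real.one_le_rpow h1 (by positivity)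
    have e2 : ‖z - w‖ ^ α ≤ (2 * r₂) ^ α :=
      Real.rpow_le_rpow hd.le (by linarith [norm_sub_le z w, hz.2, hw.2]) hα.le
    have e3 := mul_le_mul_of_nonneg_left e2 hM
    calc _ ≤ 2 * C + M + M * (2 * r₂) ^ α := by linarith
      _ ≤ _ := le_mul_of_one_le_right (by positivity) e1

/-! ### The Cauchy projection of a function with vanishing circle averages -/

theorem holderOnWith_of_norm_sub_le {C α : ℝ≥0} {f : ℂ → ℂ} {K : Set ℂ}
    (h : ∀ z ∈ K, ∀ w ∈ K, ‖f z - f w‖ ≤ C * ‖z - w‖ ^ (α : ℝ)) : HolderOnWith C α f K := by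
  intro z hz w hw
  rw [edist_nndist, edist_nndist, ← ENNReal.coe_rpow_of_nonneg _ α.coe_nonneg, ← ENNReal.coe_mul,
    ENNReal.coe_le_coe, ← NNReal.coe_le_coe]
  push_cast
  rw [dist_eq_norm, dist_eq_norm]
  exact h z hz w hw

theorem circleIntegrable_pow_mul {r₁ r₂ : ℝ} {f : ℂ → ℂ} (hf : ContinuousOn f (closedAnnulus r₁ r₂))
    (n : ℕ) {z : ℂ} (hz : z ∈ closedAnnulus r₁ r₂) :
    CircleIntegrable (fun u => u ^ n * f (u⁻¹ * z)) 0 1 :=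
  (((continuous_circleMap 0 1).pow n).mul
    (continuous_comp_circleMap_inv_mul hf hz)).intervalIntegrable _ _

theorem continuousOn_angularPart {r₁ r₂ : ℝ} {M α : ℝ≥0} {f : ℂ → ℂ} (hα : 0 < α)
    (hH : HolderOnWith M α f (closedAnnulus r₁ r₂)) (n : ℕ) :
    ContinuousOn (angularPart n f) (closedAnnulus r₁ r₂) := by
  have hf := hH.continuousOn hα
  refine (holderOnWith_of_norm_sub_le (C := M) (α := α) fun z hz w hw => ?_).continuousOn hα
  rw [angularPart, angularPart, ← Real.circleAverage_fun_sub (circleIntegrable_pow_mul hf n hz)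
    (circleIntegrable_pow_mul hf n hw),
    ← Real.circleAverage_const (M * ‖z - w‖ ^ (α : ℝ)) 0 1]
  refine norm_circleAverage_le (circleIntegrable_const _ _ _) fun u hu => ?_
  rw [abs_one, mem_sphere_zero_iff_norm] at hu
  have h2 := hH.dist_le (inv_mul_mem_closedAnnulus hz hu) (inv_mul_mem_closedAnnulus hw hu)
  rw [dist_eq_norm, dist_eq_norm, ← mul_sub u⁻¹, norm_mul, norm_inv, hu, inv_one, one_mul] at h2
  rwa [← mul_sub, norm_mul, norm_pow, hu, one_pow, one_mul]

theorem angularPart_unit_mul (n : ℕ) (f : ℂ → ℂ) (z : ℂ) {c : ℂ} (hc : ‖c‖ = 1) :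
    angularPart n f (c * z) = c ^ n * angularPart n f z := by
  have hc0 : c ≠ 0 := norm_pos_iff.1 (by rw [hc]; exact one_pos)
  have h1 := circleAverage_comp_unit_mul (fun u => u ^ n * f (u⁻¹ * (c * z))) hc 0 1
  have h2 := Real.circleAverage_fun_smul (a := c ^ n) (f := fun u : ℂ => u ^ n * f (u⁻¹ * z))
    (c := 0) (R := 1)
  rw [mul_zero] at h1
  rw [angularPart, angularPart, ← h1, ← smul_eq_mul (c ^ n), ← h2]
  congr 1
  ext u
  have : (c * u)⁻¹ * (c * z) = u⁻¹ * z := by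
    rw [mul_inv, mul_comm c⁻¹, mul_assoc, inv_mul_cancel_left₀ hc0]
  rw [this, mul_pow, smul_eq_mul, mul_assoc]

theorem IsSurroundingCircleIn.unit_mul {r₁ r₂ : ℝ} {a : ℂ} {ρ : ℝ}
    (h : IsSurroundingCircleIn (closedAnnulus r₁ r₂) a ρ) {c : ℂ} (hc : ‖c‖ = 1) :
    IsSurroundingCircleIn (closedAnnulus r₁ r₂) (c * a) ρ := by
  have hc0 : c ≠ 0 := norm_pos_iff.1 (by rw [hc]; exact one_pos)
  refine ⟨h.1, fun z hz => ?_, ?_⟩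
  · have h1 : c⁻¹ * z ∈ sphere a ρ := by
      rw [mem_sphere_iff_norm] at hz ⊢
      have : z - c * a = c * (c⁻¹ * z - a) := by rw [mul_sub, mul_inv_cancel_left₀ hc0]
      rwa [this, norm_mul, hc, one_mul] at hz
    simpa [closedAnnulus, hc] using h.2.1 h1
  · simpa [hc] using h.2.2

/-- The angular components inherit the vanishing of circle averages, because the condition is
invariant under rotations. -/
theorem circleAverage_angularPart {r₁ r₂ : ℝ} {f : ℂ → ℂ}
    (hf : ContinuousOn f (closedAnnulus r₁ r₂))
    (hmean : ∀ (a : ℂ) (ρ : ℝ), IsSurroundingCircleIn (closedAnnulus r₁ r₂) a ρ →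
      Real.circleAverage f a ρ = 0) (n : ℕ) (a : ℂ) (ρ : ℝ)
    (h : IsSurroundingCircleIn (closedAnnulus r₁ r₂) a ρ) :
    Real.circleAverage (angularPart n f) a ρ = 0 := by
  have hz : ∀ u ∈ sphere (0 : ℂ) |1|,
      Real.circleAverage (fun z => u ^ n * f (u⁻¹ * z)) a ρ = 0 := by
    intro u hu
    rw [abs_one, mem_sphere_zero_iff_norm] at hu
    have hu' : ‖u⁻¹‖ = 1 := by rw [norm_inv, hu, inv_one]
    have h2 := Real.circleAverage_fun_smul (a := u ^ n) (f := fun z : ℂ => f (u⁻¹ * z))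
      (c := a) (R := ρ)
    rw [circleAverage_comp_unit_mul f hu', hmean _ _ (h.unit_mul hu'), smul_zero] at h2
    exact h2
  have hswap := circleAverage_swap a 0 ρ 1 (G := fun u z => u ^ n * f (u⁻¹ * z)) (by
    refine Continuous.mul (by fun_prop) (hf.comp_continuous (Continuous.mul ?_ ?_) fun p => ?_)
    · exact ((continuous_circleMap 0 1).comp continuous_fst).inv₀
        fun p => circleMap_ne_center one_ne_zero
    · exact (continuous_circleMap a ρ).comp continuous_snd
    · exact circleMap_mem_closedAnnulus (h.2.1 (circleMap_mem_sphere a h.1.le _)) _)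
  exact hswap.trans (Real.circleAverage_const_on_circle hz)

theorem norm_lt_of_isSurroundingCircleIn {K : Set ℂ} {a : ℂ} {ρ : ℝ}
    (h : IsSurroundingCircleIn K a ρ) : ‖a‖ < ρ := by
  simpa using h.2.2

theorem exists_polynomial_angularPart {r₁ r₂ : ℝ} (hr₁ : 0 < r₁) (hr₂ : r₁ < r₂) {M α : ℝ≥0}
    {f : ℂ → ℂ} (hα : 0 < α) (hH : HolderOnWith M α f (closedAnnulus r₁ r₂))
    (hmean : ∀ (a : ℂ) (ρ : ℝ), IsSurroundingCircleIn (closedAnnulus r₁ r₂) a ρ →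
      Real.circleAverage f a ρ = 0) (n : ℕ) :
    ∃ p : Polynomial ℂ, p.degree < n ∧
      EqOn (angularPart n f) (conjPowMul n fun s => p.eval (s : ℂ)) (closedAnnulus r₁ r₂) :=
  exists_polynomial_of_angular hr₁ hr₂ n (continuousOn_angularPart hα hH n)
    (fun z _ _ hc => angularPart_unit_mul n f z hc)
    (circleAverage_angularPart (hH.continuousOn hα) hmean n)

/-- The tail of the geometric series for the kernel `(1 - t u)⁻¹` is `t ^ N u ^ N` times the
kernel itself. -/
theorem norm_abelMean_sub_sum_le {r₁ r₂ B : ℝ} {f : ℂ → ℂ}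
    (hf : ContinuousOn f (closedAnnulus r₁ r₂)) (hB : ∀ z ∈ closedAnnulus r₁ r₂, ‖f z‖ ≤ B)
    {t : ℝ} (h₀ : 0 ≤ t) (h₁ : t < 1) (N : ℕ) {z : ℂ} (hz : z ∈ closedAnnulus r₁ r₂) :
    ‖abelMean t f z - ∑ n ∈ Finset.range N, (t : ℂ) ^ n * angularPart n f z‖
      ≤ t ^ N * ((1 - t)⁻¹ * B) := by
  have hi : ∀ n, CircleIntegrable (fun u => (t : ℂ) ^ n * (u ^ n * f (u⁻¹ * z))) 0 1 := fun n =>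
    (circleIntegrable_pow_mul hf n hz).const_smul (a := (t : ℂ) ^ n)
  have hsum : ∑ n ∈ Finset.range N, (t : ℂ) ^ n * angularPart n f z
      = Real.circleAverage (fun u => ∑ n ∈ Finset.range N,
          (t : ℂ) ^ n * (u ^ n * f (u⁻¹ * z))) 0 1 := by
    rw [Real.circleAverage_fun_sum fun n _ => hi n]
    refine Finset.sum_congr rfl fun n _ => ?_
    exact (Real.circleAverage_fun_smul (a := (t : ℂ) ^ n)).symm
  rw [hsum, abelMean, ← Real.circleAverage_fun_sub (circleIntegrable_abelMean hf h₀ h₁ hz)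
    (CircleIntegrable.fun_sum _ fun n _ => hi n), ← Real.circleAverage_const (t ^ N * _) 0 1]
  refine norm_circleAverage_le (circleIntegrable_const _ _ _) fun u hu => ?_
  rw [abs_one, mem_sphere_zero_iff_norm] at hu
  have hne := one_sub_mul_ne_zero h₀ h₁ hu
  have e : (1 - t * u)⁻¹ * f (u⁻¹ * z)
      - ∑ n ∈ Finset.range N, (t : ℂ) ^ n * (u ^ n * f (u⁻¹ * z))
      = (t * u) ^ N * ((1 - t * u)⁻¹ * f (u⁻¹ * z)) := by
    have hg := geom_sum_mul_neg (t * u) N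
    simp only [← mul_assoc, ← mul_pow, ← Finset.sum_mul]
    have : ∑ n ∈ Finset.range N, ((t : ℂ) * u) ^ n = (1 - (t * u) ^ N) * (1 - t * u)⁻¹ := by
      rw [← hg, mul_assoc, mul_inv_cancel₀ hne, mul_one]
    rw [this]
    ring
  rw [e, norm_mul, norm_pow, norm_mul, hu, Complex.norm_real, Real.norm_of_nonneg h₀, mul_one,
    norm_mul, norm_inv]
  have hδ : 0 < 1 - t := by linarith
  gcongr
  · exact norm_one_sub_mul_ge h₀ hu
  · exact hB _ (inv_mul_mem_closedAnnulus hz hu)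

theorem isCompact_closedAnnulus (r₁ r₂ : ℝ) : IsCompact (closedAnnulus r₁ r₂) := by
  refine Metric.isCompact_of_isClosed_isBounded ?_ ?_
  · exact (isClosed_le continuous_const continuous_norm).inter
      (isClosed_le continuous_norm continuous_const)
  · exact isBounded_closedBall.subset fun z hz => mem_closedBall_zero_iff.2 hz.2

/-- The Cauchy projection extends to the disc bounded by any surrounding circle: it is a
uniform limit of Abel means, these are uniform limits of sums of angular components, and
the latter extend. -/
theorem extendsInsideVanishing_cauchyProjection {r₁ r₂ : ℝ} (hr₁ : 0 < r₁) (hr₂ : r₁ < r₂)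
    {M α : ℝ≥0} {f : ℂ → ℂ} (hα : 0 < α) (hα₁ : α < 1)
    (hH : HolderOnWith M α f (closedAnnulus r₁ r₂))
    (hmean : ∀ (a : ℂ) (ρ : ℝ), IsSurroundingCircleIn (closedAnnulus r₁ r₂) a ρ →
      Real.circleAverage f a ρ = 0) {a : ℂ} {ρ : ℝ}
    (h : IsSurroundingCircleIn (closedAnnulus r₁ r₂) a ρ) :
    ExtendsInsideVanishing (cauchyProjection f) a ρ := by
  have hf := hH.continuousOn hα
  have hH' : ∀ z ∈ closedAnnulus r₁ r₂, ∀ w ∈ closedAnnulus r₁ r₂,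
      ‖f z - f w‖ ≤ M * ‖z - w‖ ^ (α : ℝ) := fun z hz w hw => by
    simpa only [dist_eq_norm] using hH.dist_le hz hw
  have hpart : ∀ n, ExtendsInsideVanishing (angularPart n f) a ρ := by
    intro n
    obtain ⟨p, hp, he⟩ := exists_polynomial_angularPart hr₁ hr₂ hα hH hmean n
    exact (extendsInsideVanishing_conjPowMul (norm_lt_of_isSurroundingCircleIn h) hp).congr
      (he.mono h.2.1).symm
  obtain ⟨B, hB⟩ := (isCompact_closedAnnulus r₁ r₂).exists_bound_of_continuousOn hf
  have habel : ∀ t : ℝ, 0 ≤ t → t < 1 → ExtendsInsideVanishing (abelMean t f) a ρ := by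
    intro t h₀ h₁
    refine .of_approx h.1 fun ε hε => ?_
    -- The Abel mean is within `t ^ N * ((1 - t)⁻¹ * B)` of its `N`-th partial sum.
    have hlim := (tendsto_pow_atTop_nhds_zero_of_lt_one h₀ h₁).mul_const ((1 - t)⁻¹ * B)
    rw [zero_mul] at hlim
    obtain ⟨N, hN⟩ := (hlim.eventually_lt_const hε).exists
    exact ⟨_, .sum hpart (fun n => (t : ℂ) ^ n), fun z hz =>
      (norm_abelMean_sub_sum_le hf hB h₀ h₁ N (h.2.1 hz)).trans hN.le⟩
  obtain ⟨C, -, hC⟩ := exists_norm_abelMean_sub_le (hr₁.trans hr₂).le M.coe_nonneg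
    (by exact_mod_cast hα) (by exact_mod_cast hα₁) hf hH'
  refine .of_approx h.1 fun ε hε => ?_
  have hc : Continuous fun t : ℝ => C * (1 - t) ^ ((α : ℝ) / 2) := by
    have : 0 ≤ (α : ℝ) / 2 := by positivity
    fun_prop (disch := assumption)
  have hlim := hc.tendsto 1
  have hα0 : (α : ℝ) / 2 ≠ 0 := by positivity
  rw [sub_self, Real.zero_rpow hα0, mul_zero] at hlim
  obtain ⟨t, ht, ht'⟩ := ((hlim.mono_left nhdsWithin_le_nhds).eventually_lt_const hε |>.and
    (Ioo_mem_nhdsLT (zero_lt_one' ℝ))).exists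
  refine ⟨abelMean t f, habel t ht'.1.le ht'.2, fun z hz => ?_⟩
  rw [norm_sub_rev]
  exact (hC t ht'.1.le ht'.2 z (h.2.1 hz)).trans ht.le

theorem isHolderOn_cauchyProjection {r₁ r₂ : ℝ} (hr₂ : 0 ≤ r₂)
    {M α : ℝ≥0} {f : ℂ → ℂ} (hα : 0 < α) (hα₁ : α < 1)
    (hH : HolderOnWith M α f (closedAnnulus r₁ r₂)) :
    IsHolderOn (cauchyProjection f) (closedAnnulus r₁ r₂) := by
  obtain ⟨C, hC0, hC⟩ := exists_norm_cauchyProjection_sub_le hr₂ M.coe_nonneg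
    (α := α) (by exact_mod_cast hα) (by exact_mod_cast hα₁) (hH.continuousOn hα)
    fun z hz w hw => by simpa only [dist_eq_norm] using hH.dist_le hz hw
  have hα' : (α : ℝ) < 1 := by exact_mod_cast hα₁
  refine ⟨⟨C, hC0⟩, α ^ 2 / 4, by positivity, ?_, holderOnWith_of_norm_sub_le fun z hz w hw => ?_⟩
  · rw [← NNReal.coe_lt_coe]
    push_cast
    nlinarith [α.coe_nonneg]
  · simpa using! hC z hz w hw

/-- The projections to the nonnegative and to the nonpositive part of the Fourier series add up to
the function plus its zeroth component, because
`1 / (1 - u) + 1 / (1 - ū) = 1` for `|u| = 1`, `u ≠ 1`. -/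
theorem cauchyProjection_add_conj {r₁ r₂ : ℝ} {M α : ℝ≥0} {f : ℂ → ℂ} (hα : 0 < α) (hα₁ : α < 1)
    (hH : HolderOnWith M α f (closedAnnulus r₁ r₂)) {z : ℂ} (hz : z ∈ closedAnnulus r₁ r₂) :
    cauchyProjection f z
      + (starRingEnd ℂ) (cauchyProjection (fun w => (starRingEnd ℂ) (f w)) z)
      = f z + angularPart 0 f z := by
  have hf := hH.continuousOn hα
  have hH' : ∀ z ∈ closedAnnulus r₁ r₂, ∀ w ∈ closedAnnulus r₁ r₂,
      ‖f z - f w‖ ≤ M * ‖z - w‖ ^ (α : ℝ) := fun z hz w hw => by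
    simpa only [dist_eq_norm] using hH.dist_le hz hw
  have i1 := circleIntegrable_cauchyProjection M.coe_nonneg (by exact_mod_cast hα)
    (by exact_mod_cast hα₁) hf hH' hz
  have i2 := circleIntegrable_cauchyProjection (f := fun w => (starRingEnd ℂ) (f w)) M.coe_nonneg
    (by exact_mod_cast hα) (by exact_mod_cast hα₁) (Complex.continuous_conj.comp_continuousOn hf)
    (fun z hz w hw => by rw [← map_sub, RCLike.norm_conj]; exact hH' z hz w hw) hz
  have e2 := (Complex.conjCLE : ℂ →L[ℝ] ℂ).circleAverage_comp_comm i2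
  have i2' : CircleIntegrable ((Complex.conjCLE : ℂ →L[ℝ] ℂ) ∘ fun u =>
      (1 - u)⁻¹ * ((starRingEnd ℂ) (f (u⁻¹ * z)) - (starRingEnd ℂ) (f z))) 0 1 :=
    (Complex.conjCLE : ℂ →L[ℝ] ℂ).integrable_comp i2.1 |> fun h1 =>
      ⟨h1, (Complex.conjCLE : ℂ →L[ℝ] ℂ).integrable_comp i2.2⟩
  have e3 := Real.circleAverage_add i1 i2'
  rw [e2] at e3
  have e4 : Real.circleAverage (fun u => f (u⁻¹ * z) - f z) 0 1 = angularPart 0 f z - f z := by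
    have i3 := circleIntegrable_pow_mul hf 0 hz
    simp only [pow_zero, one_mul] at i3
    rw [Real.circleAverage_fun_sub i3 (circleIntegrable_const _ _ _), Real.circleAverage_const]
    simp [angularPart]
  have e5 : Real.circleAverage ((fun u => (1 - u)⁻¹ * (f (u⁻¹ * z) - f z)) +
      (Complex.conjCLE : ℂ →L[ℝ] ℂ) ∘ fun u =>
      (1 - u)⁻¹ * ((starRingEnd ℂ) (f (u⁻¹ * z)) - (starRingEnd ℂ) (f z))) 0 1
      = Real.circleAverage (fun u => f (u⁻¹ * z) - f z) 0 1 := by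
    refine Real.circleAverage_congr_sphere fun u hu => ?_
    rw [abs_one, mem_sphere_zero_iff_norm] at hu
    rcases eq_or_ne u 1 with rfl | hu1
    · simp
    have hu0 : u ≠ 0 := norm_pos_iff.1 (by rw [hu]; exact one_pos)
    have h1 : 1 - u ≠ 0 := sub_ne_zero.2 hu1.symm
    have h2 : (starRingEnd ℂ) u = u⁻¹ := (Complex.inv_eq_conj hu).symm
    have h3 : (1 - u)⁻¹ + (1 - u⁻¹)⁻¹ = 1 := by
      have h4 : 1 - u⁻¹ = -(1 - u) * u⁻¹ := by field_simp; ring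
      rw [h4]
      field_simp
      ring
    simp only [Pi.add_apply, Function.comp_apply, ContinuousLinearEquiv.coe_coe,
      Complex.conjCLE_apply, map_mul, map_inv₀, map_sub, map_one, Complex.conj_conj, h2]
    rw [← add_mul, h3, one_mul]
  rw [e5, e4] at e3
  simp only [cauchyProjection, map_add, Complex.conj_conj]
  simp only [ContinuousLinearEquiv.coe_coe, Complex.conjCLE_apply] at e3
  linear_combination -e3

/-! ### Extension to the exterior -/

open Filter Topology in
/-- Reflection in the circle turns an extension to the disc that vanishes at the centre into an
extension of the conjugate function to the exterior that vanishes at `∞`. -/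
theorem ExtendsInsideVanishing.conj_outside {h : ℂ → ℂ} {a : ℂ} {ρ : ℝ} (hρ : 0 < ρ)
    (hh : ExtendsInsideVanishing h a ρ) :
    ExtendsHolomorphicallyOutside (fun z => (starRingEnd ℂ) (h z)) a ρ := by
  obtain ⟨G, hG, hGa, hGs⟩ := hh
  have hGb : ∀ z ∈ ball a ρ, DifferentiableAt ℂ G z := fun z hz =>
    hG.differentiableAt isOpen_ball hz
  let R : ℂ → ℂ := fun z => a + ρ ^ 2 / (starRingEnd ℂ) (z - a)
  have hRn : ∀ z, ‖R z - a‖ = ρ ^ 2 / ‖z - a‖ := by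
    intro z
    simp only [R]
    rw [add_sub_cancel_left, norm_div, RCLike.norm_conj, norm_pow, Complex.norm_real,
      Real.norm_of_nonneg hρ.le]
  have hR_cl : ∀ z, z ∉ ball a ρ → R z ∈ closedBall a ρ := by
    intro z hz
    rw [mem_ball_iff_norm, not_lt] at hz
    rw [mem_closedBall_iff_norm, hRn, div_le_iff₀ (hρ.trans_le hz)]
    nlinarith
  have hR_op : ∀ z, z ∉ closedBall a ρ → R z ∈ ball a ρ := by
    intro z hz
    rw [mem_closedBall_iff_norm, not_le] at hz
    rw [mem_ball_iff_norm, hRn, div_lt_iff₀ (hρ.trans hz)]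
    nlinarith
  have hne : ∀ z, z ∉ ball a ρ → z - a ≠ 0 := by
    rintro z hz h0
    rw [sub_eq_zero.1 h0] at hz
    exact hz (mem_ball_self hρ)
  let g : OnePoint ℂ → ℂ := fun x => x.elim 0 fun z => (starRingEnd ℂ) (G (R z))
  have hg : ∀ z : ℂ, g (z : OnePoint ℂ) = (starRingEnd ℂ) (G (R z)) := fun z => rfl
  have hginf : g ∞ = 0 := rfl
  have hpre : ∀ (s : Set ℂ) (z : ℂ), (z : OnePoint ℂ) ∈ ((fun z : ℂ => (z : OnePoint ℂ)) '' s)ᶜ ↔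
      z ∉ s := by
    intro s z
    rw [mem_compl_iff, OnePoint.coe_injective.mem_set_image]
  refine ⟨g, ?_, ⟨?_, ?_⟩, hginf, ?_⟩
  · intro x hx
    induction x using OnePoint.rec with
    | infty =>
      refine ContinuousAt.continuousWithinAt (OnePoint.continuousAt_infty'.2 ?_)
      rw [hginf, coclosedCompact_eq_cocompact, ← Metric.cobounded_eq_cocompact]
      have h1 : Tendsto (fun z : ℂ => z - a) (Bornology.cobounded ℂ) (Bornology.cobounded ℂ) := by
        simp [sub_eq_add_neg]
      have h2 : Tendsto (fun z : ℂ => (starRingEnd ℂ) (z - a)⁻¹) (Bornology.cobounded ℂ) (𝓝 0) := by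
        have := (Complex.continuous_conj.tendsto 0).comp (tendsto_inv₀_cobounded.comp h1)
        rwa [map_zero] at this
      have h3 : Tendsto R (Bornology.cobounded ℂ) (𝓝 a) := by
        have := (h2.const_mul ((ρ : ℂ) ^ 2)).const_add a
        simpa [R, div_eq_mul_inv] using this
      have h4 := ((hGb a (mem_ball_self hρ)).continuousAt.tendsto.comp h3)
      rw [hGa] at h4
      simpa using! (Complex.continuous_conj.tendsto 0).comp h4
    | coe z =>
      have hz := (hpre _ z).1 hx
      rw [ContinuousWithinAt, OnePoint.nhdsWithin_coe, tendsto_map'_iff]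
      have h1 : ContinuousWithinAt R (ball a ρ)ᶜ z := by
        refine ContinuousAt.continuousWithinAt ?_
        refine continuousAt_const.add (ContinuousAt.div continuousAt_const (by fun_prop) ?_)
        exact (map_ne_zero _).2 (hne z hz)
      have h2 : ContinuousWithinAt G (closedBall a ρ) (R z) := by
        have := hG.2
        rw [closure_ball a hρ.ne'] at this
        exact this _ (hR_cl z hz)
      have h3 : ContinuousWithinAt (fun z => (starRingEnd ℂ) (G (R z))) (ball a ρ)ᶜ z :=
        Complex.continuous_conj.continuousAt.comp_continuousWithinAt
          (h2.comp h1 fun w hw => hR_cl w hw)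
      have h4 : (fun z : ℂ => (z : OnePoint ℂ)) ⁻¹' ((fun z : ℂ => (z : OnePoint ℂ)) '' ball a ρ)ᶜ
          = (ball a ρ)ᶜ := by
        ext w; exact hpre _ w
      rw [h4]
      exact h3
  · intro z hz
    have hz' := (hpre _ z).1 hz
    have h0 := hne z fun hb => hz' (ball_subset_closedBall hb)
    refine DifferentiableAt.differentiableWithinAt ?_
    have h1 : DifferentiableAt ℂ (fun w => (starRingEnd ℂ) (R w)) z := by
      have : (fun w => (starRingEnd ℂ) (R w))
          = fun w => (starRingEnd ℂ) a + (ρ : ℂ) ^ 2 / (w - a) := by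
        ext w
        simp [R]
      rw [this]
      exact (differentiableAt_const _).add
        (DifferentiableAt.div (by fun_prop) (by fun_prop) h0)
    have h2 : DifferentiableAt ℂ ((starRingEnd ℂ) ∘ G ∘ (starRingEnd ℂ))
        ((starRingEnd ℂ) (R z)) := (hGb _ (hR_op z hz')).conj_conj
    have := h2.comp z h1
    simpa [Function.comp_def] using! this
  · intro w hw
    -- In the chart at `∞` the conjugate of the reflected point is `ā + ρ² w / (1 - a w)`.
    let φ : ℂ → ℂ := fun w => (starRingEnd ℂ) a + (ρ : ℂ) ^ 2 * (w / (1 - a * w))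
    have hφR : ∀ w : ℂ, w ≠ 0 → (starRingEnd ℂ) (φ w) = R w⁻¹ := by
      intro w hw0
      have h1 : w⁻¹ - a = (1 - a * w) / w := by field_simp
      simp only [φ, R]
      rw [h1, div_eq_mul_inv ((ρ : ℂ) ^ 2), ← map_inv₀, inv_div]
      simp
    have hfun : (fun w : ℂ => g (chartAtInfty w))
        = ((starRingEnd ℂ) ∘ G ∘ (starRingEnd ℂ)) ∘ φ := by
      ext w
      simp only [Function.comp_apply, chartAtInfty]
      split_ifs with hw0
      · simp [hw0, φ, hGa, hginf]
      · rw [hg, hφR w hw0]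
    have hmem : 1 - a * w ≠ 0 ∧ (starRingEnd ℂ) (φ w) ∈ ball a ρ := by
      rcases eq_or_ne w 0 with rfl | hw0
      · simpa [φ] using hρ
      · have hw1 : w⁻¹ ∉ closedBall a ρ := by
          rw [mem_ofPred_eq, chartAtInfty, if_neg hw0] at hw
          exact (hpre _ _).1 hw
        refine ⟨fun h1 => hne w⁻¹ (fun hb => hw1 (ball_subset_closedBall hb)) ?_, ?_⟩
        · have : w⁻¹ - a = (1 - a * w) / w := by field_simp
          rw [this, h1, zero_div]
        · rw [hφR w hw0]
          exact hR_op _ hw1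
    refine DifferentiableAt.differentiableWithinAt ?_
    rw [hfun]
    refine DifferentiableAt.comp w ?_ ?_
    · have := (hGb _ hmem.2).conj_conj
      rwa [Complex.conj_conj] at this
    · exact (differentiableAt_const _).add
        ((differentiableAt_const _).mul (DifferentiableAt.div (by fun_prop) (by fun_prop) hmem.1))
  · intro z hz
    have hz0 : z - a ≠ 0 := hne z fun hb => (mem_ball.1 hb).ne hz
    have hRz : R z = z := by
      have h1 : (z - a) * (starRingEnd ℂ) (z - a) = ρ ^ 2 := by
        rw [Complex.mul_conj', mem_sphere_iff_norm.1 hz]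
      have h2 : (starRingEnd ℂ) (z - a) ≠ 0 := (map_ne_zero _).2 hz0
      simp only [R]
      rw [← h1, mul_div_cancel_right₀ _ h2]
      ring
    rw [hg, hRz, hGs hz]

/-! ### The decomposition -/

theorem theorem1p1 (r₁ r₂ : ℝ) (hr₁ : 0 < r₁) (hr₂ : r₁ < r₂) (f : ℂ → ℂ)
    (hf : IsHolderOn f (closedAnnulus r₁ r₂))
    (hmean : ∀ (a : ℂ) (ρ : ℝ), IsSurroundingCircleIn (closedAnnulus r₁ r₂) a ρ →
      Real.circleAverage f a ρ = 0) :
    ∃ fp fm : ℂ → ℂ,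
      (∀ z ∈ closedAnnulus r₁ r₂, f z = fp z + fm z) ∧
      IsHolderOn fp (closedAnnulus r₁ r₂) ∧
      IsHolderOn fm (closedAnnulus r₁ r₂) ∧
      ∀ (a : ℂ) (ρ : ℝ), IsSurroundingCircleIn (closedAnnulus r₁ r₂) a ρ →
        ExtendsHolomorphicallyInside fp a ρ ∧ ExtendsHolomorphicallyOutside fm a ρ := by
  obtain ⟨M, α, hα, hα₁, hH⟩ := hf
  have hc := hH.continuousOn hα
  let fc : ℂ → ℂ := fun w => (starRingEnd ℂ) (f w)
  have hHc : HolderOnWith M α fc (closedAnnulus r₁ r₂) := by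
    intro z hz w hw
    have : edist (fc z) (fc w) = edist (f z) (f w) := by
      simp only [fc, edist_dist, Complex.dist_conj_conj]
    rw [this]
    exact hH z hz w hw
  have hmeanc : ∀ (a : ℂ) (ρ : ℝ), IsSurroundingCircleIn (closedAnnulus r₁ r₂) a ρ →
      Real.circleAverage fc a ρ = 0 := by
    intro a ρ h
    have := (Complex.conjCLE : ℂ →L[ℝ] ℂ).circleAverage_comp_comm
      ((hc.mono h.2.1).circleIntegrable h.1.le)
    rw [hmean a ρ h, map_zero] at this
    exact this
  refine ⟨cauchyProjection f, fun z => (starRingEnd ℂ) (cauchyProjection fc z), fun z hz => ?_,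
    isHolderOn_cauchyProjection (hr₁.trans hr₂).le hα hα₁ hH, ?_, fun a ρ h => ⟨?_, ?_⟩⟩
  · -- A polynomial of degree less than `0` is zero, so the zeroth angular component vanishes.
    obtain ⟨p, hp, he⟩ := exists_polynomial_angularPart hr₁ hr₂ hα hH hmean 0
    have hp0 : p = 0 := by simpa using hp
    rw [cauchyProjection_add_conj hα hα₁ hH hz, he hz, hp0]
    simp [conjPowMul]
  · obtain ⟨C, β, hβ, hβ₁, hC⟩ := isHolderOn_cauchyProjection (hr₁.trans hr₂).le hα hα₁ hHc
    refine ⟨C, β, hβ, hβ₁, fun z hz w hw => ?_⟩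
    simpa only [edist_dist, Complex.dist_conj_conj] using hC z hz w hw
  · obtain ⟨g, hg, -, hs⟩ := extendsInsideVanishing_cauchyProjection hr₁ hr₂ hα hα₁ hH hmean h
    refine ⟨g, ?_, hg.1, hs⟩
    simpa [closure_ball a h.1.ne'] using hg.2
  · exact (extendsInsideVanishing_cauchyProjection hr₁ hr₂ hα hα₁ hHc hmeanc h).conj_outside h.1
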